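/- Let $\mathfrak g$ be one of $A_n$ ($n\ge 1$), $D_n$ ($n\ge 4$), $E_6,E_7,E_8$, with rank $r$ and Cartan matrix $C_{\mathfrak g}$. Nodes are numbered as in Bourbaki: $A_n$ is the chain $1-\dots-n$; $D_n$ is the chain $1-\dots-(n-2)$ with $n-1$ and $n$ attached to $n-2$; $E_r$ is the chain $1-3-4-\dots-r$ with $2$ attached to $4$. Coweights $\lambda\in\mathbb Z^r$ are written in the basis of fundamental coweights $\omega_1,\dots,\omega_r$. Let $\Gamma^{\ge0}=\{\lambda\in C_{\mathfrak g}\mathbb Z^r:\lambda_i\ge 0 \text{ for all } i\}$ be the set of dominant coweights in the coroot lattice, and let $\lambda\le\mu$ mean that $\mu-\lambda\in C_{\mathfrak g}\mathbb N^r$, i.e. that $\mu-\lambda$ is a sum of simple coroots (dominance order). Let $Y_{\mathfrak g}\in\mathbb C[x,y,z]$ be the Du Val polynomial $Y_{A_n}=xy+z^{n+1}$, $Y_{D_n}=x^2+zy^2+z^{n-1}$, $Y_{E_6}=x^2+y^3+z^4$, $Y_{E_7}=x^2+y^3+yz^3$, $Y_{E_8}=x^2+y^3+z^5$. The distinguished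 coweights $\mu_i$ and polynomials $w_i$ are the following pairs $(\mu_i, w_i)$: * $A_n$: $((n+1)\omega_1,\,x)$, $((n+1)\omega_n,\,y)$, $(\omega_1+\omega_n,\,z)$; * $D_n$, $n=2j$: $(\omega_1+\omega_{n-1}+\omega_n,\,x)$, $(2\omega_1,\,z)$, $(2\omega_{n-1},\,y+iz^{j-1})$, $(2\omega_n,\,y-iz^{j-1})$; * $D_n$, $n=2j+1$: $(\omega_{n-1}+\omega_n,\,y)$, $(2\omega_1,\,z)$, $(\omega_1+2\omega_n,\,x-iz^j)$, $(\omega_1+2\omega_{n-1},\,x+iz^j)$, $(4\omega_n,\,y^2+2iz^{j-1}(x-iz^j))$, $(4\omega_{n-1},\,y^2-2iz^{j-1}(x+iz^j))$; * $E_6$: $(\omega_1+\omega_6,\,y)$, $(\omega_2,\,z)$, $(3\omega_1,\,x+iz^2)$, $(3\omega_6,\,x-iz^2)$; * $E_7$: $(\omega_2+\omega_7,\,x)$, $(2\omega_7,\,y)$, $(\omega_1,\,z)$, $(2\omega_2,\,y^2+z^3)$; * $E_8$: $(\omega_2,\,x)$, $(\omega_1,\,y)$, $(\omega_8,\,z)$.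 For $\mu\in\Gamma^{\ge0}$ let $I_\mu\subset\mathbb C[x,y,z]$ be the ideal generated by the products $\prod_i w_i^{n_i}$ over all $n_i\in\mathbb N$ with $\sum_i n_i\mu_i=\mu$ (so $I_0=(1)$, and $I_\mu=0$ if there is no such decomposition). For $\lambda\in\Gamma^{\ge0}$ let $\widetilde I_\lambda=\sum_{\mu\in\Gamma^{\ge0},\,\mu\ge\lambda}I_\mu$. Let $\widetilde{\mathsf Y}_{\mathfrak g}$ be the minimal resolution of the Du Val singularity $\{Y_{\mathfrak g}=0\}\subset\mathbb C^3$, and let $C_1,\dots,C_r$ be its exceptional curves, numbered by the nodes of the Dynkin diagram that they form; where the diagram has a symmetry, the numbering is fixed by the requirements that $x$ vanishes to order $n+1-k$ along $C_k$ for $A_n$; that $z$ vanishes to order $2$ along $C_1$, and $y+iz^{j-1}$ ($n=2j$), resp. $x+iz^j$ ($n=2j+1$), to a higher order along $C_{n-1}$ than along $C_n$ for $D_n$; and that $x+iz^2$ vanishes to a higher order along $C_1$ than along $C_6$ for $E_6$. For $\lambda\in\Gamma^{\ge0}$ let $\mathsf Q_\lambda$ be the balanced special unitary quiver in the shape of the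 Dynkin diagram, with flavor labels $\lambda$ and gauge labels $C_{\mathfrak g}^{-1}\cdot\lambda$. The threefold $\{Y_{\mathfrak g}(x,y,z)=0,\ uv=P(x,y,z)\}$ is said to realize a quiver if the gauge label at each node $k$ is the vanishing order along $C_k$ of the pull-back of $P$ to $\widetilde{\mathsf Y}_{\mathfrak g}$, and the flavor labels are those determined by balancing (flavor label plus adjacent gauge labels equals twice the gauge label). **Proposition.** Let $P\in\mathbb C[x,y,z]$ be a polynomial that does not vanish identically on $\{Y_{\mathfrak g}=0\}$. Then the set of all $\lambda\in\Gamma^{\ge0}$ such that the class of $P$ in $\mathbb C[x,y,z]/(Y_{\mathfrak g})$ lies in the ideal generated by $\widetilde I_\lambda$ has a greatest element $\lambda(P)$ for the order $\le$, and the threefold $\{Y_{\mathfrak g}(x,y,z)=0,\ uv=P(x,y,z)\}$ realizes the quiver $\mathsf Q_{\lambda(P)}$: for every $k$, the vanishing order along $C_k$ of the pull-back of $P$ to the minimal resolution is $(C_{\mathfrak g}^{-1}\cdot\lambda(P))_k$. -/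

import Mathlib

/-- The ADE types: `A n` is `A_n` (`n ≥ 1`), `Deven j` is `D_{2j}` and `Dodd j` is `D_{2j+1}`
(`j ≥ 2`).  In all types the nodes of the Dynkin diagram are numbered as in Bourbaki and in
Mathlib's `CartanMatrix`; node number `i` (counted from `1`) is the element `i - 1` of `Fin rank`. -/
inductive DuValType
  | A (n : ℕ) (hn : 1 ≤ n)
  | Deven (j : ℕ) (hj : 2 ≤ j)
  | Dodd (j : ℕ) (hj : 2 ≤ j)
  | E6
  | E7
  | E8

namespace DuValType

/-! ### Lie theory: coweights, coroot lattice, dominance order -/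

/-- The rank of the Lie algebra. -/
abbrev rank : DuValType → ℕ
  | A n _ => n
  | Deven j _ => 2 * j
  | Dodd j _ => 2 * j + 1
  | E6 => 6
  | E7 => 7
  | E8 => 8

/-- The Cartan matrix. -/
def cartan : (g : DuValType) → Matrix (Fin g.rank) (Fin g.rank) ℤ
  | A n _ => CartanMatrix.A n
  | Deven j _ => CartanMatrix.D (2 * j)
  | Dodd j _ => CartanMatrix.D (2 * j + 1)
  | E6 => CartanMatrix.E₆
  | E7 => CartanMatrix.E₇
  | E8 => CartanMatrix.E₈

/-- A coweight, given by its Dynkin labels `α_i(λ)`, i.e. by its coordinates in the basis of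
fundamental coweights. -/
abbrev Coweight (g : DuValType) : Type := Fin g.rank → ℤ

/-- The fundamental coweight `ω_i`, with nodes counted from `1`. -/
def fundCoweight (r i : ℕ) : Fin r → ℤ := fun k => if (k : ℕ) + 1 = i then 1 else 0

/-- The set `Γ_r^{≥ 0}` of dominant coweights in the coroot lattice.  The Dynkin labels of the
simple coroots are the columns of the (symmetric) Cartan matrix. -/
def dominantCoroot (g : DuValType) : Set g.Coweight :=
  {lam | (∀ i, 0 ≤ lam i) ∧ ∃ r : Fin g.rank → ℤ, g.cartan.mulVec r = lam}

/-- The dominance order: `λ ≤ μ` if `μ - λ` is a combination of simple coroots with coefficients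
in `ℕ`. -/
def DomLE (g : DuValType) (lam mu : g.Coweight) : Prop :=
  ∃ c : Fin g.rank → ℕ, mu - lam = g.cartan.mulVec (fun i => (c i : ℤ))

/-! ### The Du Val polynomials and the distinguished polynomials -/

open MvPolynomial in
/-- The polynomial `Y_g` in the variables `x = X 0`, `y = X 1`, `z = X 2`. -/
noncomputable def duVal : DuValType → MvPolynomial (Fin 3) ℂ
  | A n _ => X 0 * X 1 + X 2 ^ (n + 1)
  | Deven j _ => X 0 ^ 2 + X 2 * X 1 ^ 2 + X 2 ^ (2 * j - 1)
  | Dodd j _ => X 0 ^ 2 + X 2 * X 1 ^ 2 + X 2 ^ (2 * j)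
  | E6 => X 0 ^ 2 + X 1 ^ 3 + X 2 ^ 4
  | E7 => X 0 ^ 2 + X 1 ^ 3 + X 1 * X 2 ^ 3
  | E8 => X 0 ^ 2 + X 1 ^ 3 + X 2 ^ 5

/-- The number of distinguished coweights. -/
abbrev numDist : DuValType → ℕ
  | A _ _ => 3
  | Deven _ _ => 4
  | Dodd _ _ => 6
  | E6 => 4
  | E7 => 4
  | E8 => 3

/-- The distinguished coweights `μ_1, …, μ_s`. -/
def distCoweight : (g : DuValType) → Fin g.numDist → g.Coweight
  | A n _ =>
      ![((n : ℤ) + 1) • fundCoweight n 1,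
        ((n : ℤ) + 1) • fundCoweight n n,
        fundCoweight n 1 + fundCoweight n n]
  | Deven j _ =>
      ![fundCoweight (2 * j) 1 + fundCoweight (2 * j) (2 * j - 1) + fundCoweight (2 * j) (2 * j),
        (2 : ℤ) • fundCoweight (2 * j) 1,
        (2 : ℤ) • fundCoweight (2 * j) (2 * j - 1),
        (2 : ℤ) • fundCoweight (2 * j) (2 * j)]
  | Dodd j _ =>
      ![fundCoweight (2 * j + 1) (2 * j) + fundCoweight (2 * j + 1) (2 * j + 1),
        (2 : ℤ) • fundCoweight (2 * j + 1) 1,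
        fundCoweight (2 * j + 1) 1 + (2 : ℤ) • fundCoweight (2 * j + 1) (2 * j + 1),
        fundCoweight (2 * j + 1) 1 + (2 : ℤ) • fundCoweight (2 * j + 1) (2 * j),
        (4 : ℤ) • fundCoweight (2 * j + 1) (2 * j + 1),
        (4 : ℤ) • fundCoweight (2 * j + 1) (2 * j)]
  | E6 =>
      ![fundCoweight 6 1 + fundCoweight 6 6,
        fundCoweight 6 2,
        (3 : ℤ) • fundCoweight 6 1,
        (3 : ℤ) • fundCoweight 6 6]
  | E7 =>
      ![fundCoweight 7 2 + fundCoweight 7 7,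
        (2 : ℤ) • fundCoweight 7 7,
        fundCoweight 7 1,
        (2 : ℤ) • fundCoweight 7 2]
  | E8 =>
      ![fundCoweight 8 2,
        fundCoweight 8 1,
        fundCoweight 8 8]

open MvPolynomial in
/-- The distinguished polynomials `w_1, …, w_s`. -/
noncomputable def distPoly : (g : DuValType) → Fin g.numDist → MvPolynomial (Fin 3) ℂ
  | A _ _ => ![X 0, X 1, X 2]
  | Deven j _ =>
      ![X 0,
        X 2,
        X 1 + C Complex.I * X 2 ^ (j - 1),
        X 1 - C Complex.I * X 2 ^ (j - 1)]
  | Dodd j _ =>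
      ![X 1,
        X 2,
        X 0 - C Complex.I * X 2 ^ j,
        X 0 + C Complex.I * X 2 ^ j,
        X 1 ^ 2 + C (2 * Complex.I) * X 2 ^ (j - 1) * (X 0 - C Complex.I * X 2 ^ j),
        X 1 ^ 2 - C (2 * Complex.I) * X 2 ^ (j - 1) * (X 0 + C Complex.I * X 2 ^ j)]
  | E6 =>
      ![X 1,
        X 2,
        X 0 + C Complex.I * X 2 ^ 2,
        X 0 - C Complex.I * X 2 ^ 2]
  | E7 =>
      ![X 0,
        X 1,
        X 2,
        X 1 ^ 2 + X 2 ^ 3]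
  | E8 =>
      ![X 0,
        X 1,
        X 2]

/-- The ideal `I_μ` of `ℂ[x,y,z]`, generated by the products `w_1^{n_1} ⋯ w_s^{n_s}` over all
decompositions `μ = n_1 μ_1 + ⋯ + n_s μ_s` with `n_i ∈ ℕ`. -/
noncomputable def idealI (g : DuValType) (mu : g.Coweight) : Ideal (MvPolynomial (Fin 3) ℂ) :=
  Ideal.span {p | ∃ n : Fin g.numDist → ℕ,
    ∑ i, n i • g.distCoweight i = mu ∧ p = ∏ i, g.distPoly i ^ n i}

/-- The ideal `Ĩ_λ`, the sum of the ideals `I_μ` over all dominant `μ ≥ λ` in the coroot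
lattice. -/
noncomputable def idealTilde (g : DuValType) (lam : g.Coweight) :
    Ideal (MvPolynomial (Fin 3) ℂ) :=
  ⨆ mu ∈ {mu | mu ∈ g.dominantCoroot ∧ g.DomLE lam mu}, g.idealI mu

/-- The coordinate ring `ℂ[x,y,z]/(Y_g)` of the Du Val singularity. -/
abbrev CoordRing (g : DuValType) : Type := MvPolynomial (Fin 3) ℂ ⧸ Ideal.span {g.duVal}

/-- The set of those `λ ∈ Γ_r^{≥ 0}` for which the function on the Du Val singularity defined by
`P` lies in (the ideal of the coordinate ring generated by) `Ĩ_λ`. -/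
def coweightSet (g : DuValType) (P : MvPolynomial (Fin 3) ℂ) : Set g.Coweight :=
  {lam | lam ∈ g.dominantCoroot ∧
    (Ideal.Quotient.mk (Ideal.span {g.duVal}) P : g.CoordRing) ∈
      (g.idealTilde lam).map (Ideal.Quotient.mk (Ideal.span {g.duVal}))}

/-- `lam` is `λ(P)`: the greatest element, for the dominance order, of the set of those
`λ ∈ Γ_r^{≥ 0}` with `P ∈ Ĩ_λ`. -/
def IsLambdaOf (g : DuValType) (P : MvPolynomial (Fin 3) ℂ) (lam : g.Coweight) : Prop :=
  lam ∈ g.coweightSet P ∧ ∀ nu ∈ g.coweightSet P, g.DomLE nu lam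

/-! ### The minimal resolution in its toric ambient space

The minimal resolution of the Du Val singularity is described, as a hypersurface in a toric
ambient space (for `A_n`: as a toric surface), by its homogeneous coordinates:

* one coordinate `e_i` for each node `i` of the Dynkin diagram, `C_i = {e_i = 0}` being the
  corresponding exceptional curve;
* one coordinate `d_l` for each end `l` of the Dynkin diagram (two for `A_n`, also for `n = 1`;
  three for `D_n` and `E_n`), `{d_l = 0}` being a non-compact curve which meets the exceptional
  curves transversally in one point of the curve of the node at this end.

The torus `(ℂ^*)^rank` acts; `d_l` has the weight `ω_i` if `l` is at the node `i`, and `e_i` has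
as its weight minus the `i`-th column of the Cartan matrix (the degrees of the line bundles
`𝒪(C_i)` on the exceptional curves).  The coordinates satisfy one equation `properTransform`,
which expresses the linear dependence of three sections of degree one on the curve
of the trivalent node; there is none for `A_n`.  The point set is the locus where at most
two coordinates vanish, and two only if their curves meet, modulo the torus.  The functions of
weight `0` are the functions on the Du Val singularity; the blow-down map expresses `x`, `y`, `z`
through the coordinates. -/

/-- The number of ends of the Dynkin diagram. In types `D` and `E` the three ends are, in order,
the nodes `1, n - 1, n` for `D_n`, the nodes `1, 2, 6` for `E_6`, the nodes `1, 2, 7` for `E_7`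
and the nodes `1, 2, 8` for `E_8`; in type `A` they are the nodes `1, n`. -/
abbrev numEnds : DuValType → ℕ
  | A _ _ => 2
  | _ => 3

/-- The monomial `∏ d_l^{a_l} ∏ e_i^{b_i}` in the homogeneous coordinates. -/
noncomputable def coordMonomial {k r : ℕ} (a : Fin k → ℕ) (b : Fin r → ℕ) :
    MvPolynomial (Fin k ⊕ Fin r) ℂ :=
  (∏ l, MvPolynomial.X (Sum.inl l) ^ a l) * ∏ i, MvPolynomial.X (Sum.inr i) ^ b i

open MvPolynomial in
/-- The equation of the minimal resolution in the toric ambient space. -/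
noncomputable def properTransform :
    (g : DuValType) → MvPolynomial (Fin g.numEnds ⊕ Fin g.rank) ℂ
  | A _ _ => 0
  | Deven j _ =>
      (coordMonomial ![0, 2, 0] (fun i => if (i : ℕ) + 1 = 2 * j - 1 then 1 else 0)
        - coordMonomial ![0, 0, 2] (fun i => if (i : ℕ) + 1 = 2 * j then 1 else 0)
        - C (2 * Complex.I) *
          coordMonomial ![2 * j - 2, 0, 0] (fun i => 2 * j - 2 - ((i : ℕ) + 1)) :
        MvPolynomial (Fin 3 ⊕ Fin (2 * j)) ℂ)
  | Dodd j _ =>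
      (coordMonomial ![0, 2, 0] (fun i => if (i : ℕ) + 1 = 2 * j then 1 else 0)
        - coordMonomial ![0, 0, 2] (fun i => if (i : ℕ) + 1 = 2 * j + 1 then 1 else 0)
        - C (2 * Complex.I) *
          coordMonomial ![2 * j - 1, 0, 0] (fun i => 2 * j - 1 - ((i : ℕ) + 1)) :
        MvPolynomial (Fin 3 ⊕ Fin (2 * j + 1)) ℂ)
  | E6 =>
      (coordMonomial ![3, 0, 0] ![2, 0, 1, 0, 0, 0]
        - coordMonomial ![0, 0, 3] ![0, 0, 0, 0, 1, 2]
        - C (2 * Complex.I) * coordMonomial ![0, 2, 0] ![0, 1, 0, 0, 0, 0] :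
        MvPolynomial (Fin 3 ⊕ Fin 6) ℂ)
  | E7 =>
      (coordMonomial ![0, 0, 4] ![0, 0, 0, 0, 1, 2, 3]
        + coordMonomial ![3, 0, 0] ![2, 0, 1, 0, 0, 0, 0]
        - coordMonomial ![0, 2, 0] ![0, 1, 0, 0, 0, 0, 0] :
        MvPolynomial (Fin 3 ⊕ Fin 7) ℂ)
  | E8 =>
      (coordMonomial ![0, 2, 0] ![0, 1, 0, 0, 0, 0, 0, 0]
        + coordMonomial ![3, 0, 0] ![2, 0, 1, 0, 0, 0, 0, 0]
        + coordMonomial ![0, 0, 5] ![0, 0, 0, 0, 1, 2, 3, 4] :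
        MvPolynomial (Fin 3 ⊕ Fin 8) ℂ)

open MvPolynomial in
/-- The blow-down map: the coordinates `x`, `y`, `z` in terms of the homogeneous coordinates. -/
noncomputable def blowdown :
    (g : DuValType) → Fin 3 → MvPolynomial (Fin g.numEnds ⊕ Fin g.rank) ℂ
  | A n _ =>
      (![coordMonomial ![n + 1, 0] (fun i => n - (i : ℕ)),
         -coordMonomial ![0, n + 1] (fun i => (i : ℕ) + 1),
         coordMonomial ![1, 1] (fun _ => 1)] :
        Fin 3 → MvPolynomial (Fin 2 ⊕ Fin n) ℂ)
  | Deven j _ =>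
      let z : MvPolynomial (Fin 3 ⊕ Fin (2 * j)) ℂ :=
        coordMonomial ![2, 0, 0] (fun i => if (i : ℕ) + 1 ≤ 2 * j - 2 then 2 else 1)
      (![C Complex.I * coordMonomial ![1, 1, 1]
            (fun i => if (i : ℕ) + 1 ≤ 2 * j - 2 then (i : ℕ) + 2 else j),
         coordMonomial ![0, 2, 0]
            (fun i => if (i : ℕ) + 1 ≤ 2 * j - 2 then (i : ℕ) + 1
              else if (i : ℕ) + 1 = 2 * j - 1 then j else j - 1)
            - C Complex.I * z ^ (j - 1),
         z] :
        Fin 3 → MvPolynomial (Fin 3 ⊕ Fin (2 * j)) ℂ)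
  | Dodd j _ =>
      let z : MvPolynomial (Fin 3 ⊕ Fin (2 * j + 1)) ℂ :=
        coordMonomial ![2, 0, 0] (fun i => if (i : ℕ) + 1 ≤ 2 * j - 1 then 2 else 1)
      (![coordMonomial ![1, 0, 2]
            (fun i => if (i : ℕ) + 1 ≤ 2 * j - 1 then (i : ℕ) + 2
              else if (i : ℕ) + 1 = 2 * j then j else j + 1)
            + C Complex.I * z ^ j,
         C Complex.I * coordMonomial ![0, 1, 1]
            (fun i => if (i : ℕ) + 1 ≤ 2 * j - 1 then (i : ℕ) + 1 else j),
         z] :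
        Fin 3 → MvPolynomial (Fin 3 ⊕ Fin (2 * j + 1)) ℂ)
  | E6 =>
      let z : MvPolynomial (Fin 3 ⊕ Fin 6) ℂ := coordMonomial ![0, 1, 0] ![1, 2, 2, 3, 2, 1]
      (![coordMonomial ![3, 0, 0] ![4, 3, 5, 6, 4, 2] - C Complex.I * z ^ 2,
         -coordMonomial ![1, 0, 1] ![2, 2, 3, 4, 3, 2],
         z] :
        Fin 3 → MvPolynomial (Fin 3 ⊕ Fin 6) ℂ)
  | E7 =>
      (![C Complex.I * coordMonomial ![0, 1, 1] ![3, 5, 6, 9, 7, 5, 3],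
         coordMonomial ![0, 0, 2] ![2, 3, 4, 6, 5, 4, 3],
         coordMonomial ![1, 0, 0] ![2, 2, 3, 4, 3, 2, 1]] :
        Fin 3 → MvPolynomial (Fin 3 ⊕ Fin 7) ℂ)
  | E8 =>
      (![coordMonomial ![0, 1, 0] ![5, 8, 10, 15, 12, 9, 6, 3],
         coordMonomial ![1, 0, 0] ![4, 5, 7, 10, 8, 6, 4, 2],
         coordMonomial ![0, 0, 1] ![2, 3, 4, 6, 5, 4, 3, 2]] :
        Fin 3 → MvPolynomial (Fin 3 ⊕ Fin 8) ℂ)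

/-- The homogeneous coordinate ring of the minimal resolution. -/
abbrev ResRing (g : DuValType) : Type :=
  MvPolynomial (Fin g.numEnds ⊕ Fin g.rank) ℂ ⧸ Ideal.span {g.properTransform}

/-- The pull-back of a polynomial `P(x,y,z)` to the minimal resolution. -/
noncomputable def pullback (g : DuValType) (P : MvPolynomial (Fin 3) ℂ) : g.ResRing :=
  Ideal.Quotient.mk _ (MvPolynomial.aeval g.blowdown P)

/-- The (prime) ideal of the exceptional curve `C_j`. -/
noncomputable def curveIdeal (g : DuValType) (j : Fin g.rank) : Ideal g.ResRing :=
  Ideal.span {Ideal.Quotient.mk _ (MvPolynomial.X (Sum.inr j))}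

/-- `f` vanishes to order at least `n` along the curve with prime ideal `I`: in the localization
at `I`, it lies in the `n`-th power of the maximal ideal. -/
def VanishesToOrder {R : Type} [CommRing R] (I : Ideal R) (f : R) (n : ℕ) : Prop :=
  ∃ s, s ∉ I ∧ s * f ∈ I ^ n

/-- `n` is the vanishing order along the exceptional curve `C_j` of the pull-back of `P` to the
minimal resolution. -/
def IsVanishingOrder (g : DuValType) (P : MvPolynomial (Fin 3) ℂ) (j : Fin g.rank) (n : ℕ) :
    Prop :=
  IsGreatest {m | VanishesToOrder (g.curveIdeal j) (g.pullback P) m} n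

/-! ### Dynkin quivers -/

/-- The labels of a special unitary quiver (with vanishing Chern-Simons levels) in the shape of
the Dynkin diagram. -/
structure DynkinQuiver (g : DuValType) where
  gauge : Fin g.rank → ℚ
  flavor : Fin g.rank → ℚ

/-- The quiver is balanced: at each node, flavor label plus adjacent gauge labels equals twice the
gauge label. -/
def DynkinQuiver.Balanced {g : DuValType} (Q : DynkinQuiver g) : Prop :=
  ∀ i, Q.flavor i = ∑ j, (g.cartan i j : ℚ) * Q.gauge j

/-- The quiver `Q_λ`, with flavor labels `λ` and gauge labels `C_g⁻¹ · λ`. -/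
noncomputable def quiver (g : DuValType) (lam : g.Coweight) : DynkinQuiver g where
  gauge := (g.cartan.map (Int.cast : ℤ → ℚ))⁻¹.mulVec (fun i => (lam i : ℚ))
  flavor := fun i => (lam i : ℚ)

/-- The threefold `{Y_g(x,y,z) = 0, uv = P(x,y,z)}` realizes the quiver `Q`.  Its partial
resolution is `{uv = P}` over the minimal resolution of the Du Val singularity; the gauge label of
the node `j` is the vanishing order of the brane locus `P = 0` along the exceptional curve `C_j`,
and the flavor labels are those that make the quiver balanced. -/
def RealizesQuiver (g : DuValType) (P : MvPolynomial (Fin 3) ℂ) (Q : DynkinQuiver g) : Prop :=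
  (∀ j, ∃ n : ℕ, g.IsVanishingOrder P j n ∧ Q.gauge j = n) ∧ Q.Balanced

end DuValType

/-! Everything is computed in the homogeneous coordinate ring `ResRing` of the minimal resolution:
the polynomial ring in the end coordinates d_l and the curve coordinates e_j, modulo one trinomial h
(h = 0 in type A). It is graded by coweights, and functions on the singularity pull back to elements
of weight 0. A monomial d^a e^b has weight 0 exactly when C·b equals the coweight given by a, so C·b
is then automatically dominant. A finite check in each type shows that the monomials of weight 0 are
the products of the distinguished ones, which are, up to nonzero scalars and modulo h, the
pull-backs of the w_i. Such a monomial is therefore the pull-back of a scalar multiple of a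
generator of I_μ with μ = C·b.

Each e_j is prime in this ring and no e_j divides another, so the vanishing order m_j of P along C_j
is the multiplicity of e_j in the pull-back, and the product of the e_j^{m_j} divides it. Lifting
this factorization to polynomials and keeping only the component of weight 0 writes the pull-back as
a sum of weight 0 monomials with b ≥ m (`MonomialModel.exists_support`). Since b ≥ m means C·b ≥ C·m
in the dominance order, P lies in Ĩ_λ for λ = C·m (`MonomialModel.exists_mem_idealTilde`); here the
injectivity of the pull-back on the coordinate ring is used. This λ is dominant: for each j some
monomial has b_j = m_j, and the off-diagonal entries of C are nonpositive.

Conversely, every element of Ĩ_ν with ν = C·b vanishes to order at least b_j along C_j, so b ≤ m and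
ν ≤ λ. Hence λ(P) = C·m, and its gauge labels are the vanishing orders.

Factoriality of the ring is never needed, only the primality of the e_j. It comes from the shape of
h: three terms in disjoint sets of variables, each with a variable of exponent one, of which at
least two survive when a variable is set to zero. -/

namespace DuValType

open MvPolynomial

/-! ### Hypersurfaces with prime coordinate divisors -/

section PrimeDivisors

variable {σ : Type*} [DecidableEq σ]

/-- Setting the variable `v` to zero. -/
noncomputable def restrictZero (v : σ) : MvPolynomial σ ℂ →ₐ[ℂ] MvPolynomial σ ℂ :=
  aeval fun s => if s = v then 0 else X s

theorem X_dvd_sub_restrictZero (v : σ) (f : MvPolynomial σ ℂ) : X v ∣ f - restrictZero v f := by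
  induction f using MvPolynomial.induction_on with
  | C a => simp [restrictZero]
  | add p q hp hq =>
    rw [map_add, add_sub_add_comm]
    exact dvd_add hp hq
  | mul_X p s hp =>
    rw [map_mul]
    by_cases hs : s = v
    · subst hs
      simp [restrictZero]
    · have : restrictZero v (X s : MvPolynomial σ ℂ) = X s := by simp [restrictZero, hs]
      rw [this, ← sub_mul]
      exact hp.mul_right _

/-- The class of `X v` divides that of `f` modulo `h` iff this holds after restriction to
`X v = 0`. -/
theorem mk_X_dvd_mk_iff (h f : MvPolynomial σ ℂ) (v : σ) :
    Ideal.Quotient.mk (Ideal.span {h}) (X v) ∣ Ideal.Quotient.mk (Ideal.span {h}) f ↔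
      restrictZero v h ∣ restrictZero v f := by
  constructor
  · rintro ⟨q, hq⟩
    obtain ⟨q, rfl⟩ := Ideal.Quotient.mk_surjective q
    rw [← map_mul, Ideal.Quotient.eq, Ideal.mem_span_singleton] at hq
    have := map_dvd (restrictZero v) hq
    simpa [restrictZero] using this
  · rintro ⟨t, ht⟩
    obtain ⟨a, ha⟩ := X_dvd_sub_restrictZero v f
    obtain ⟨b, hb⟩ := X_dvd_sub_restrictZero v h
    refine ⟨Ideal.Quotient.mk _ (a - b * t), ?_⟩
    rw [← map_mul, Ideal.Quotient.eq, Ideal.mem_span_singleton]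
    exact ⟨t, by linear_combination ha + ht - t * hb⟩

/-- The hypersurface `h = 0` is integral, and the coordinates indexed by the image of `ι` cut out
pairwise distinct prime divisors on it. -/
structure HasPrimeDivisors {J : Type*} (ι : J → σ) (h : MvPolynomial σ ℂ) : Prop where
  prime : (Ideal.span {h}).IsPrime
  prime_restrict : ∀ j, (Ideal.span {restrictZero (ι j) h}).IsPrime
  not_dvd_restrict : ∀ i j, i ≠ j → ¬ restrictZero (ι j) h ∣ X (ι i)
  not_dvd : ∀ j, ¬ h ∣ X (ι j)

variable {J : Type*} {ι : J → σ} {h : MvPolynomial σ ℂ}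

/-- Modulo the coordinate, the hypersurface ring becomes the polynomial ring modulo the restricted
equation, so primality is that of the restricted equation. -/
theorem HasPrimeDivisors.prime_X (H : HasPrimeDivisors ι h) (j : J) :
    Prime (Ideal.Quotient.mk (Ideal.span {h}) (X (ι j))) := by
  have key := fun a b => (H.prime_restrict j).mem_or_mem (x := a) (y := b)
  simp only [Ideal.mem_span_singleton] at key
  refine ⟨fun h0 => H.not_dvd j ?_, fun hu => (H.prime_restrict j).ne_top ?_, fun a b => ?_⟩
  · rwa [Ideal.Quotient.eq_zero_iff_mem, Ideal.mem_span_singleton] at h0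
  · have := hu.dvd (a := Ideal.Quotient.mk (Ideal.span {h}) 1)
    rw [mk_X_dvd_mk_iff, map_one] at this
    exact Ideal.span_singleton_eq_top.2 (isUnit_of_dvd_one this)
  · obtain ⟨a, rfl⟩ := Ideal.Quotient.mk_surjective a
    obtain ⟨b, rfl⟩ := Ideal.Quotient.mk_surjective b
    rw [← map_mul, mk_X_dvd_mk_iff, mk_X_dvd_mk_iff, mk_X_dvd_mk_iff, map_mul]
    exact fun hd => key _ _ hd

theorem HasPrimeDivisors.not_X_dvd_X (hι : Function.Injective ι)
    (H : HasPrimeDivisors ι h) {i j : J} (hij : i ≠ j) :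
    ¬ Ideal.Quotient.mk (Ideal.span {h}) (X (ι j)) ∣
      Ideal.Quotient.mk (Ideal.span {h}) (X (ι i)) := by
  rw [mk_X_dvd_mk_iff]
  have : restrictZero (ι j) (X (ι i) : MvPolynomial σ ℂ) = X (ι i) := by
    simp [restrictZero, hι.ne hij]
  rw [this]
  exact H.not_dvd_restrict i j hij

/-- Divisibility by powers of non-associated primes can be checked one prime at a time. -/
theorem prod_pow_dvd_of_forall {R J : Type*} [CommRing R] [IsDomain R] [DecidableEq J]
    (e : J → R) (he : ∀ j, Prime (e j)) (hne : ∀ i j, i ≠ j → ¬ e j ∣ e i) (m : J → ℕ) (f : R)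
    (hf : ∀ j, e j ^ m j ∣ f) (s : Finset J) : ∏ j ∈ s, e j ^ m j ∣ f := by
  induction s using Finset.induction_on with
  | empty => simp
  | insert a s ha ih =>
    obtain ⟨g, rfl⟩ := ih
    rw [Finset.prod_insert ha, mul_comm]
    -- The prime `e a` divides none of the other factors, so its power passes to the cofactor `g`.
    refine mul_dvd_mul_left _ ((he a).pow_dvd_of_dvd_mul_left _ (fun hd => ?_) (hf a))
    obtain ⟨i, hi, hd⟩ := ((he a).dvd_finsetProd_iff _).1 hd
    refine hne i a ?_ ((he a).dvd_of_dvd_pow hd)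
    rintro rfl
    exact ha hi

end PrimeDivisors

/-! ### Trinomials with disjoint supports -/

section Trinomial

variable {σ : Type*}

theorem coeff_sum_monomial (c : Fin 3 → ℂ) (m : Fin 3 → σ →₀ ℕ)
    (hm : Function.Injective m) (l : Fin 3) :
    coeff (m l) (∑ l, monomial (m l) (c l)) = c l := by
  classical
  rw [coeff_sum, Finset.sum_eq_single l]
  · simp
  · intro b _ hb
    rw [coeff_monomial, if_neg (hm.ne hb)]
  · simp

/-- A polynomial whose exponents are among three exponents with disjoint supports, each of which
contains a variable with exponent one, is irreducible and not divisible by a variable, as soon as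
at least two coefficients are nonzero. -/
theorem irreducible_trinomial (c : Fin 3 → ℂ) (m : Fin 3 → σ →₀ ℕ) (u : Fin 3 → σ)
    (hu : ∀ l, m l (u l) = 1) (hd : ∀ l l' s, l ≠ l' → m l s ≠ 0 → m l' s = 0)
    (h2 : ∃ l l', l ≠ l' ∧ c l ≠ 0 ∧ c l' ≠ 0) :
    Irreducible (∑ l, monomial (m l) (c l)) ∧ ∀ s, ¬ X s ∣ ∑ l, monomial (m l) (c l) := by
  classical
  have hinj : Function.Injective m := by
    intro l l' hl
    by_contra hne
    have := hd l l' (u l) hne (by simp [hu])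
    rw [← hl, hu] at this
    simp at this
  have hsupp : ∀ d ∈ (∑ l, monomial (m l) (c l)).support, ∃ l, d = m l := by
    intro d hd
    by_contra! hne
    rw [mem_support_iff, coeff_sum] at hd
    refine hd (Finset.sum_eq_zero fun l _ => ?_)
    rw [coeff_monomial, if_neg (hne l).symm]
  obtain ⟨l, l', hne, hl, hl'⟩ := h2
  have hml : m l ∈ (∑ l, monomial (m l) (c l)).support := by
    rwa [mem_support_iff, coeff_sum_monomial c m hinj]
  have hml' : m l' ∈ (∑ l, monomial (m l) (c l)).support := by
    rwa [mem_support_iff, coeff_sum_monomial c m hinj]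
  refine ⟨irreducible_of_disjoint_support (d := m l) (i := u l)
    ⟨m l, hml, m l', hml', hinj.ne hne⟩ hml (hu l) ?_ ?_, ?_⟩
  · intro d hd' d' hd'' hdd
    obtain ⟨a, rfl⟩ := hsupp d hd'
    obtain ⟨b, rfl⟩ := hsupp d' hd''
    rw [Function.onFun, Finset.disjoint_left]
    intro s hs hs'
    rw [Finsupp.mem_support_iff] at hs hs'
    exact hs' (hd a b s (fun hab => hdd (by rw [hab])) hs)
  · intro r hr
    have := hr (m l)
    rw [coeff_sum_monomial c m hinj] at this
    exact isUnit_of_dvd_unit this (IsUnit.mk0 _ hl)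
  -- A variable occurs in at most one of the exponents, so one of the two nonzero terms survives
  -- modulo that variable.
  · rintro s hs
    obtain ⟨a, ha, has⟩ : ∃ a, c a ≠ 0 ∧ m a s = 0 := by
      by_cases h0 : m l s = 0
      · exact ⟨l, hl, h0⟩
      · exact ⟨l', hl', hd l l' s hne h0⟩
    rw [X_dvd_iff_modMonomial_eq_zero] at hs
    have := congrArg (coeff (m a)) hs
    rw [coeff_modMonomial_of_not_le, coeff_sum_monomial c m hinj] at this
    · exact ha (by simpa using this)
    · rw [Finsupp.single_le_iff]
      omega

variable [DecidableEq σ]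

theorem restrictZero_monomial (v : σ) (m : σ →₀ ℕ) (c : ℂ) :
    restrictZero v (monomial m c) = monomial m (if m v = 0 then c else 0) := by
  rw [restrictZero, aeval_monomial, monomial_eq, Finsupp.prod, Finsupp.prod]
  split_ifs with h
  · congr 1
    refine Finset.prod_congr rfl fun s hs => ?_
    rw [if_neg]
    rintro rfl
    simp [h] at hs
  · rw [Finset.prod_eq_zero (i := v) (by simpa using h)]
    · simp
    · simp [h]

theorem hasPrimeDivisors_trinomial {J : Type*} (ι : J → σ) (c : Fin 3 → ℂ) (hc : ∀ l, c l ≠ 0)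
    (m : Fin 3 → σ →₀ ℕ) (u : Fin 3 → σ) (hu : ∀ l, m l (u l) = 1)
    (hd : ∀ l l' s, l ≠ l' → m l s ≠ 0 → m l' s = 0) :
    HasPrimeDivisors ι (∑ l, monomial (m l) (c l)) := by
  have h1 := irreducible_trinomial c m u hu hd ⟨0, 1, by decide, hc 0, hc 1⟩
  have h2 : ∀ v, Irreducible (restrictZero v (∑ l, monomial (m l) (c l))) ∧
      ∀ s, ¬ X s ∣ restrictZero v (∑ l, monomial (m l) (c l)) := by
    intro v
    simp only [map_sum, restrictZero_monomial]
    refine irreducible_trinomial _ m u hu hd ?_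
    -- At most one of the three terms involves `v`, so at least two survive after setting it to zero
    -- and the restriction is again covered by `irreducible_trinomial`.
    by_cases h0 : m 0 v = 0
    · by_cases h1 : m 1 v = 0
      · exact ⟨0, 1, by decide, by simp [h0, hc], by simp [h1, hc]⟩
      · have := hd 1 2 v (by decide) h1
        exact ⟨0, 2, by decide, by simp [h0, hc], by simp [this, hc]⟩
    · have h1 := hd 0 1 v (by decide) h0
      have h2 := hd 0 2 v (by decide) h0
      exact ⟨1, 2, by decide, by simp [h1, hc], by simp [h2, hc]⟩
  have h3 : ∀ (p : MvPolynomial σ ℂ), Irreducible p → (∀ s, ¬ X s ∣ p) → ∀ s, ¬ p ∣ X s :=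
    fun p hp hX s hs => hX s ((hp.dvd_symm (X_prime (R := ℂ)).irreducible) hs)
  exact ⟨(Ideal.span_singleton_prime h1.1.ne_zero).2 h1.1.prime,
    fun j => (Ideal.span_singleton_prime (h2 _).1.ne_zero).2 (h2 _).1.prime,
    fun i j _ => h3 _ (h2 _).1 (h2 _).2 _, fun j => h3 _ h1.1 h1.2 _⟩

/-- This is the toric case of type `A`, where the homogeneous coordinate ring is a polynomial ring.
-/
theorem hasPrimeDivisors_zero {J : Type*} (ι : J → σ) :
    HasPrimeDivisors ι (0 : MvPolynomial σ ℂ) := by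
  have : (Ideal.span {(0 : MvPolynomial σ ℂ)}).IsPrime := by
    rw [Ideal.span_singleton_eq_bot.2 rfl]
    exact Ideal.isPrime_bot
  refine ⟨this, fun j => by rwa [map_zero], fun i j _ => ?_, fun j => ?_⟩ <;>
    simp [zero_dvd_iff, X_ne_zero]

end Trinomial

/-! ### Monomials and weights -/

/-- The exponent of `coordMonomial a b`. -/
noncomputable def coordExponent {k r : ℕ} (a : Fin k → ℕ) (b : Fin r → ℕ) :
    (Fin k ⊕ Fin r) →₀ ℕ :=
  Finsupp.equivFunOnFinite.symm (Sum.elim a b)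

@[simp] theorem coordExponent_inl {k r : ℕ} (a : Fin k → ℕ) (b : Fin r → ℕ) (l : Fin k) :
    coordExponent a b (Sum.inl l) = a l := rfl

@[simp] theorem coordExponent_inr {k r : ℕ} (a : Fin k → ℕ) (b : Fin r → ℕ) (j : Fin r) :
    coordExponent a b (Sum.inr j) = b j := rfl

theorem coordMonomial_eq_monomial {k r : ℕ} (a : Fin k → ℕ) (b : Fin r → ℕ) :
    coordMonomial a b = monomial (coordExponent a b) 1 := by
  rw [monomial_eq, Finsupp.prod_fintype _ _ (fun _ => pow_zero _), Fintype.prod_sum_type,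
    coordMonomial]
  simp

theorem coordMonomial_mul {k r : ℕ} (a a' : Fin k → ℕ) (b b' : Fin r → ℕ) :
    coordMonomial a b * coordMonomial a' b' = coordMonomial (a + a') (b + b') := by
  simp only [coordMonomial_eq_monomial, monomial_mul, one_mul]
  congr 2
  ext (s | s) <;> simp

theorem coordMonomial_pow {k r : ℕ} (a : Fin k → ℕ) (b : Fin r → ℕ) (n : ℕ) :
    coordMonomial a b ^ n = coordMonomial (n • a) (n • b) := by
  simp only [coordMonomial_eq_monomial, monomial_pow, one_pow]
  congr 2
  ext (s | s) <;> simp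

theorem coordMonomial_prod {k r s : ℕ} (a : Fin s → Fin k → ℕ) (b : Fin s → Fin r → ℕ) :
    ∏ i, coordMonomial (a i) (b i) = coordMonomial (∑ i, a i) (∑ i, b i) := by
  simp only [coordMonomial_eq_monomial]
  rw [← monomial_sum_one]
  congr 2
  ext (s | s) <;> simp [Finsupp.finsetSum_apply]

/-- The weight of a combination of ends, in fundamental coweights. -/
def endWeight {k r : ℕ} (node : Fin k → Fin r) (a : Fin k → ℕ) : Fin r → ℤ :=
  fun t => ∑ l, if node l = t then (a l : ℤ) else 0

/-- The weights of the homogeneous coordinates: fundamental coweights for the coordinates of the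
ends, minus the columns of the Cartan matrix for those of the exceptional curves. -/
def coordWeight {k r : ℕ} (M : Matrix (Fin r) (Fin r) ℤ) (node : Fin k → Fin r) :
    Fin k ⊕ Fin r → (Fin r → ℤ) :=
  Sum.elim (fun l t => if node l = t then 1 else 0) (fun j t => -M t j)

theorem weight_coordWeight {k r : ℕ} (M : Matrix (Fin r) (Fin r) ℤ) (node : Fin k → Fin r)
    (d : (Fin k ⊕ Fin r) →₀ ℕ) :
    Finsupp.weight (coordWeight M node) d =
      endWeight node (fun l => d (Sum.inl l)) - M.mulVec (fun j => (d (Sum.inr j) : ℤ)) := by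
  rw [Finsupp.weight_apply, Finsupp.sum_fintype _ _ (by simp), Fintype.sum_sum_type]
  ext t
  rw [Pi.add_apply, Pi.sub_apply, sub_eq_add_neg, Finset.sum_apply, Finset.sum_apply, endWeight,
    Matrix.mulVec, dotProduct, ← Finset.sum_neg_distrib]
  congr 1 <;> refine Finset.sum_congr rfl fun j _ => ?_
  · simp [coordWeight]
  · simp [coordWeight, mul_comm]

/-- The component of weight `0` of a multiple of a homogeneous polynomial `h` is a multiple
of `h`. -/
theorem dvd_weightedHomogeneousComponent_zero {σ M : Type*} [AddCommMonoid M] {w : σ → M}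
    {h : MvPolynomial σ ℂ} {τ : M} (hh : IsWeightedHomogeneous w h τ) (t : MvPolynomial σ ℂ) :
    h ∣ weightedHomogeneousComponent w 0 (h * t) := by
  classical
  induction t using MvPolynomial.induction_on' with
  | monomial d c =>
    -- Multiplied by a single monomial, `h` stays homogeneous, so its component of weight 0 is
    -- either all of it or zero.
    have := hh.mul (isWeightedHomogeneous_monomial w d c rfl)
    rw [weightedHomogeneousComponent_of_mem ((mem_weightedHomogeneousSubmodule _ _ _ _).2 this)]
    split_ifs
    · exact dvd_mul_right _ _
    · exact dvd_zero _
  | add p q hp hq =>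
    rw [mul_add, map_add]
    exact dvd_add hp hq

/-! ### The combinatorial model -/

/-- The distinguished polynomials pull back to multiples of monomials in the homogeneous
coordinates, and these generate the monomials of weight `0`. -/
structure MonomialModel (g : DuValType) where
  /-- The node at an end. -/
  node : Fin g.numEnds → Fin g.rank
  /-- The exponents of the coordinates of the ends in the distinguished monomials. -/
  endExp : Fin g.numDist → Fin g.numEnds → ℕ
  /-- The exponents of the coordinates of the curves in the distinguished monomials. -/
  curveExp : Fin g.numDist → Fin g.rank → ℕ
  /-- The coefficients of the distinguished monomials. -/
  scalar : Fin g.numDist → ℂ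
  scalar_ne_zero : ∀ i, scalar i ≠ 0
  hasPrimeDivisors : HasPrimeDivisors (Sum.inr : Fin g.rank → _) g.properTransform
  homogeneous : ∃ τ, IsWeightedHomogeneous (coordWeight g.cartan node) g.properTransform τ
  pullback_distPoly : ∀ i, g.properTransform ∣
    aeval g.blowdown (g.distPoly i) - C (scalar i) * coordMonomial (endExp i) (curveExp i)
  cartan_mulVec_curveExp : ∀ i, g.cartan.mulVec (fun j => (curveExp i j : ℤ)) = g.distCoweight i
  endWeight_endExp : ∀ i, endWeight node (endExp i) = g.distCoweight i
  -- Only the end exponents need to be decomposed: the curve exponents of a weight 0 monomial are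
  -- determined by them, because the Cartan matrix is injective.
  exists_endExp_eq_sum : ∀ a (b : Fin g.rank → ℕ),
    g.cartan.mulVec (fun j => (b j : ℤ)) = endWeight node a → ∃ n : Fin g.numDist → ℕ,
      a = ∑ i, n i • endExp i
  cartan_injective : ∀ b : Fin g.rank → ℤ, g.cartan.mulVec b = 0 → b = 0
  cartan_nonpos : ∀ i j, i ≠ j → g.cartan i j ≤ 0
  X_mem_range : ∀ t : Fin 3, (X t : MvPolynomial (Fin 3) ℂ) ∈ (aeval (R := ℂ) g.distPoly).range
  dvd_duVal : g.properTransform ∣ aeval g.blowdown g.duVal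
  -- With `dvd_duVal`, this says that the pull-back is well defined and injective on the coordinate
  -- ring.
  duVal_dvd : ∀ f, g.properTransform ∣ aeval g.blowdown f → g.duVal ∣ f

theorem endWeight_add {k r : ℕ} (node : Fin k → Fin r) (a a' : Fin k → ℕ) :
    endWeight node (a + a') = endWeight node a + endWeight node a' := by
  ext t
  simp only [endWeight, Pi.add_apply, ← Finset.sum_add_distrib]
  refine Finset.sum_congr rfl fun l _ => ?_
  split_ifs <;> simp

theorem endWeight_nsmul {k r : ℕ} (node : Fin k → Fin r) (a : Fin k → ℕ) (n : ℕ) :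
    endWeight node (n • a) = n • endWeight node a := by
  ext t
  simp [endWeight, Finset.mul_sum]

theorem endWeight_sum {k r s : ℕ} (node : Fin k → Fin r) (a : Fin s → Fin k → ℕ) :
    endWeight node (∑ i, a i) = ∑ i, endWeight node (a i) :=
  map_sum (AddMonoidHom.mk' (endWeight node) (endWeight_add node)) a Finset.univ

theorem endWeight_nonneg {k r : ℕ} (node : Fin k → Fin r) (a : Fin k → ℕ) (t : Fin r) :
    0 ≤ endWeight node a t := by
  refine Finset.sum_nonneg fun l _ => ?_
  split_ifs <;> simp

namespace MonomialModel

variable {g : DuValType}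

theorem cartan_mulVec_sum (D : MonomialModel g) (n : Fin g.numDist → ℕ) :
    g.cartan.mulVec (fun j => ((∑ i, n i • D.curveExp i) j : ℤ)) =
      ∑ i, n i • g.distCoweight i := by
  simp only [← D.cartan_mulVec_curveExp, ← Matrix.mulVec_smul, ← Matrix.mulVec_sum]
  congr 1
  ext j
  simp

/-- A monomial of weight `0` is a product of distinguished monomials. -/
theorem exists_eq_sum (D : MonomialModel g) (a : Fin g.numEnds → ℕ) (b : Fin g.rank → ℕ)
    (h : g.cartan.mulVec (fun j => (b j : ℤ)) = endWeight D.node a) :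
    ∃ n : Fin g.numDist → ℕ, a = ∑ i, n i • D.endExp i ∧ b = ∑ i, n i • D.curveExp i := by
  obtain ⟨n, hn⟩ := D.exists_endExp_eq_sum a b h
  refine ⟨n, hn, ?_⟩
  have h1 : g.cartan.mulVec (fun j => (b j : ℤ) - ((∑ i, n i • D.curveExp i) j : ℕ)) = 0 := by
    have : (fun j => (b j : ℤ) - ((∑ i, n i • D.curveExp i) j : ℕ)) =
      (fun j => (b j : ℤ)) - fun j => (((∑ i, n i • D.curveExp i) j : ℕ) : ℤ) := rfl
    rw [this, Matrix.mulVec_sub, D.cartan_mulVec_sum, h, hn, endWeight_sum]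
    simp only [endWeight_nsmul, D.endWeight_endExp, sub_self]
  ext j
  have := congrFun (D.cartan_injective _ h1) j
  simp only [Pi.zero_apply] at this
  omega

theorem pullback_prod (D : MonomialModel g) (n : Fin g.numDist → ℕ) :
    g.properTransform ∣ aeval g.blowdown (∏ i, g.distPoly i ^ n i) -
      C (∏ i, D.scalar i ^ n i) *
        coordMonomial (∑ i, n i • D.endExp i) (∑ i, n i • D.curveExp i) := by
  have h : ∀ i, Ideal.Quotient.mk (Ideal.span {g.properTransform})
      (aeval g.blowdown (g.distPoly i)) = Ideal.Quotient.mk _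
        (C (D.scalar i) * coordMonomial (D.endExp i) (D.curveExp i)) := fun i => by
    rw [Ideal.Quotient.eq, Ideal.mem_span_singleton]
    exact D.pullback_distPoly i
  rw [← Ideal.mem_span_singleton, ← Ideal.Quotient.eq, map_prod, map_prod]
  simp only [map_pow, h]
  rw [← coordMonomial_prod]
  simp only [← coordMonomial_pow, map_prod, map_pow, map_mul, mul_pow, Finset.prod_mul_distrib]

/-- Every pull-back is congruent to a polynomial of weight `0`. -/
theorem exists_homogeneous (D : MonomialModel g) (P : MvPolynomial (Fin 3) ℂ) :
    ∃ G, IsWeightedHomogeneous (coordWeight g.cartan D.node) G 0 ∧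
      g.properTransform ∣ aeval g.blowdown P - G := by
  -- The induction runs over polynomials in the w_i, because these are known to pull back to
  -- monomials of weight 0 modulo the equation.
  obtain ⟨F, rfl⟩ : ∃ F, aeval g.distPoly F = P := by
    have h : (aeval (R := ℂ) (X : Fin 3 → MvPolynomial (Fin 3) ℂ)).range ≤
        (aeval (R := ℂ) g.distPoly).range := by
      rw [← Algebra.adjoin_range_eq_range_aeval, Algebra.adjoin_le_iff]
      rintro _ ⟨t, rfl⟩
      exact D.X_mem_range t
    exact h ⟨P, by simp⟩
  induction F using MvPolynomial.induction_on with
  | C c => exact ⟨C c, isWeightedHomogeneous_C _ _, by simp⟩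
  | add p q hp hq =>
    obtain ⟨G, hG, hp⟩ := hp
    obtain ⟨G', hG', hq⟩ := hq
    refine ⟨G + G', hG.add hG', ?_⟩
    rw [map_add, map_add, add_sub_add_comm]
    exact dvd_add hp hq
  | mul_X p i hp =>
    obtain ⟨G, hG, q, hq⟩ := hp
    obtain ⟨q', hq'⟩ := D.pullback_distPoly i
    refine ⟨G * (C (D.scalar i) * coordMonomial (D.endExp i) (D.curveExp i)), ?_,
      q * aeval g.blowdown (g.distPoly i) + G * q', ?_⟩
    · have : IsWeightedHomogeneous (coordWeight g.cartan D.node)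
          (coordMonomial (D.endExp i) (D.curveExp i)) 0 := by
        rw [coordMonomial_eq_monomial]
        refine isWeightedHomogeneous_monomial _ _ _ ?_
        rw [weight_coordWeight]
        simp [D.cartan_mulVec_curveExp, D.endWeight_endExp]
      simpa using hG.mul ((isWeightedHomogeneous_C _ _).mul this)
    · rw [map_mul, aeval_X, map_mul]
      linear_combination aeval g.blowdown (g.distPoly i) * hq + G * hq'

/-! ### Vanishing orders along the exceptional curves -/

/-- The prime element of the homogeneous coordinate ring defining an exceptional curve. -/
noncomputable def _root_.DuValType.curveEq (g : DuValType) (j : Fin g.rank) : g.ResRing :=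
  Ideal.Quotient.mk _ (X (Sum.inr j))

theorem isDomain (D : MonomialModel g) : IsDomain g.ResRing :=
  (Ideal.Quotient.isDomain_iff_prime _).2 D.hasPrimeDivisors.prime

theorem prime_curveEq (D : MonomialModel g) (j : Fin g.rank) : Prime (g.curveEq j) :=
  D.hasPrimeDivisors.prime_X j

/-- The ideal of the curve is generated by a prime element, and a factor outside this ideal can be
cancelled from a divisibility by a power of that element. So the order in the localization is the
multiplicity of the prime. -/
theorem vanishesToOrder_iff (D : MonomialModel g) (j : Fin g.rank) (f : g.ResRing) (n : ℕ) :
    VanishesToOrder (g.curveIdeal j) f n ↔ g.curveEq j ^ n ∣ f := by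
  have := D.isDomain
  have hI : g.curveIdeal j = Ideal.span {g.curveEq j} := rfl
  rw [VanishesToOrder, hI]
  simp only [Ideal.span_singleton_pow, Ideal.mem_span_singleton]
  constructor
  · rintro ⟨s, hs, hd⟩
    exact (D.prime_curveEq j).pow_dvd_of_dvd_mul_left n hs hd
  · intro h
    exact ⟨1, (D.prime_curveEq j).not_dvd_one, by rwa [one_mul]⟩

/-- A polynomial all of whose monomials have weight `0` and order at least `m` along the
exceptional curves is congruent to the pull-back of an element of `Ĩ_λ`, `λ` being the image of
`m` under the Cartan matrix. -/
theorem exists_mem_idealTilde (D : MonomialModel g) (m : Fin g.rank → ℕ)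
    (G : MvPolynomial (Fin g.numEnds ⊕ Fin g.rank) ℂ)
    (hG : ∀ d ∈ G.support, Finsupp.weight (coordWeight g.cartan D.node) d = 0)
    (hm : ∀ d ∈ G.support, ∀ j, m j ≤ d (Sum.inr j)) :
    ∃ Q ∈ g.idealTilde (g.cartan.mulVec fun j => (m j : ℤ)),
      g.properTransform ∣ aeval g.blowdown Q - G := by
  have key : ∀ d ∈ G.support, ∃ Q ∈ g.idealTilde (g.cartan.mulVec fun j => (m j : ℤ)),
      g.properTransform ∣ aeval g.blowdown Q - monomial d (coeff d G) := by
    intro d hd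
    have h0 := hG d hd
    rw [weight_coordWeight, sub_eq_zero] at h0
    obtain ⟨n, ha, hb⟩ := D.exists_eq_sum _ _ h0.symm
    have hu : (∏ i, D.scalar i ^ n i) ≠ 0 :=
      Finset.prod_ne_zero_iff.2 fun i _ => pow_ne_zero _ (D.scalar_ne_zero i)
    -- The product of the w_i pulls back to the monomial times the product of the scalars, which has
    -- to be divided out.
    refine ⟨C (coeff d G * (∏ i, D.scalar i ^ n i)⁻¹) * ∏ i, g.distPoly i ^ n i,
      Ideal.mul_mem_left _ _ ?_, ?_⟩
    · have hmu := D.cartan_mulVec_sum n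
      rw [← hb] at hmu
      -- The relevant μ is C·b for the curve exponents b of `d`. It is dominant because it equals
      -- the weight of the end part, and μ − C·m = C·(b − m) with b ≥ m.
      refine Ideal.mem_iSup_of_mem (∑ i, n i • g.distCoweight i) (Ideal.mem_iSup_of_mem
        ⟨⟨fun i => ?_, _, hmu⟩, fun j => d (Sum.inr j) - m j, ?_⟩
          (Ideal.subset_span ⟨n, rfl, rfl⟩))
      · rw [← hmu, ← h0]
        exact endWeight_nonneg _ _ _
      · rw [← hmu, ← Matrix.mulVec_sub]
        congr 1
        ext j
        simp [hm d hd j]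
    · obtain ⟨q, hq⟩ := D.pullback_prod n
      rw [← ha, ← hb, coordMonomial_eq_monomial] at hq
      have hd' : coordExponent (fun l => d (Sum.inl l)) (fun j => d (Sum.inr j)) = d := by
        ext (s | s) <;> rfl
      have hmon : monomial d (coeff d G) =
          C (coeff d G * (∏ i, D.scalar i ^ n i)⁻¹) *
            (C (∏ i, D.scalar i ^ n i) * monomial d 1) := by
        rw [← mul_assoc, ← C_mul, C_mul_monomial, mul_one, mul_assoc, inv_mul_cancel₀ hu,
          mul_one]
      rw [hd'] at hq
      refine ⟨C (coeff d G * (∏ i, D.scalar i ^ n i)⁻¹) * q, ?_⟩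
      rw [hmon, map_mul, ← algebraMap_eq, AlgHom.commutes, algebraMap_eq]
      linear_combination C (coeff d G * (∏ i, D.scalar i ^ n i)⁻¹) * hq
  choose! Q hQ hQ' using key
  refine ⟨∑ d ∈ G.support, Q d, Ideal.sum_mem _ hQ, ?_⟩
  nth_rw 2 [G.as_sum]
  rw [map_sum, ← Finset.sum_sub_distrib]
  exact Finset.dvd_sum hQ'

/-- A function vanishing to order `m` along the exceptional curves is a combination of monomials
of weight `0` with this property. -/
theorem exists_support (D : MonomialModel g) (P : MvPolynomial (Fin 3) ℂ) (m : Fin g.rank → ℕ)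
    (h : ∀ j, g.curveEq j ^ m j ∣ g.pullback P) :
    ∃ G : MvPolynomial (Fin g.numEnds ⊕ Fin g.rank) ℂ,
      (∀ d ∈ G.support, Finsupp.weight (coordWeight g.cartan D.node) d = 0) ∧
      (∀ d ∈ G.support, ∀ j, m j ≤ d (Sum.inr j)) ∧
      g.properTransform ∣ aeval g.blowdown P - G := by
  classical
  have := D.isDomain
  obtain ⟨G, hG, hPG⟩ := D.exists_homogeneous P
  obtain ⟨s, hs⟩ := prod_pow_dvd_of_forall g.curveEq D.prime_curveEq
    (fun i j hij => D.hasPrimeDivisors.not_X_dvd_X Sum.inr_injective hij) m _ h Finset.univ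
  obtain ⟨s, rfl⟩ := Ideal.Quotient.mk_surjective s
  have hprod : ∏ j, g.curveEq j ^ m j =
      Ideal.Quotient.mk (Ideal.span {g.properTransform}) (coordMonomial 0 m) := by
    simp [coordMonomial, curveEq]
  rw [hprod, ← map_mul, pullback, Ideal.Quotient.eq, Ideal.mem_span_singleton] at hs
  have hGs : g.properTransform ∣ G - coordMonomial 0 m * s := by
    have := dvd_sub hs hPG
    rwa [sub_sub_sub_cancel_left] at this
  obtain ⟨t, ht⟩ := hGs
  obtain ⟨τ, hτ⟩ := D.homogeneous
  -- Since `G` has weight 0 and the equation is homogeneous, the congruence between `G` and e^m·s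
  -- persists when the latter is replaced by its component of weight 0. This selects some of its
  -- monomials, all still divisible by e^m.
  have h0 := dvd_weightedHomogeneousComponent_zero hτ t
  rw [← ht, map_sub, hG.weightedHomogeneousComponent_same] at h0
  refine ⟨weightedHomogeneousComponent (coordWeight g.cartan D.node) 0 (coordMonomial 0 m * s),
    fun d hd => ?_, fun d hd j => ?_, by simpa only [sub_add_sub_cancel] using dvd_add hPG h0⟩
  · rw [mem_support_iff, coeff_weightedHomogeneousComponent] at hd
    by_contra hne
    simp [hne] at hd
  · rw [mem_support_iff, coeff_weightedHomogeneousComponent] at hd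
    have hd' : coeff d (coordMonomial 0 m * s) ≠ 0 := fun h0 => by simp [h0] at hd
    rw [coordMonomial_eq_monomial, coeff_monomial_mul'] at hd'
    have hle : coordExponent 0 m ≤ d := by
      by_contra hle
      simp [hle] at hd'
    exact hle (Sum.inr j)

theorem pow_curveEq_dvd (P : MvPolynomial (Fin 3) ℂ) (j : Fin g.rank) (n : ℕ)
    (G : MvPolynomial (Fin g.numEnds ⊕ Fin g.rank) ℂ) (hn : ∀ d ∈ G.support, n ≤ d (Sum.inr j))
    (h : g.properTransform ∣ aeval g.blowdown P - G) : g.curveEq j ^ n ∣ g.pullback P := by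
  have hG : X (Sum.inr j) ^ n ∣ G := by
    rw [G.as_sum]
    refine Finset.dvd_sum fun d hd => ?_
    rw [X_pow_eq_monomial, monomial_dvd_monomial]
    exact ⟨Or.inr (Finsupp.single_le_iff.2 (hn d hd)), one_dvd _⟩
  have : g.pullback P = Ideal.Quotient.mk _ G := by
    rw [pullback, Ideal.Quotient.eq, Ideal.mem_span_singleton]
    exact h
  rw [this, curveEq, ← map_pow]
  exact map_dvd _ hG

/-- The vanishing orders along the exceptional curves of an element of `Ĩ_λ`. -/
theorem pow_curveEq_dvd_of_mem_coweightSet (D : MonomialModel g)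
    (P : MvPolynomial (Fin 3) ℂ) (b : Fin g.rank → ℤ)
    (h : g.cartan.mulVec b ∈ g.coweightSet P) (j : Fin g.rank) :
    g.curveEq j ^ (b j).toNat ∣ g.pullback P := by
  -- The pull-back factors through the coordinate ring, and divisibility by a fixed element defines
  -- an ideal, so only the generators of the ideals I_μ have to be checked.
  have hY : Ideal.span {g.duVal} ≤ RingHom.ker ((Ideal.Quotient.mk
      (Ideal.span {g.properTransform})).comp (aeval (R := ℂ) g.blowdown).toRingHom) := by
    rw [Ideal.span_singleton_le_iff_mem, RingHom.mem_ker]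
    exact Ideal.Quotient.eq_zero_iff_mem.2 (Ideal.mem_span_singleton.2 D.dvd_duVal)
  let φ : g.CoordRing →+* g.ResRing := Ideal.Quotient.lift _ _ hY
  have hφ : ∀ f, φ (Ideal.Quotient.mk _ f) = g.pullback f := fun f => rfl
  rw [← Ideal.mem_span_singleton, ← hφ, ← Ideal.mem_comap]
  refine (Ideal.map_le_iff_le_comap.2 ?_ : Ideal.map _ _ ≤ _) h.2
  refine iSup_le fun mu => iSup_le fun hmu => Ideal.span_le.2 ?_
  rintro _ ⟨n, rfl, rfl⟩
  rw [SetLike.mem_coe, Ideal.mem_comap, Ideal.mem_comap, hφ, Ideal.mem_span_singleton]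
  obtain ⟨c, hc⟩ := hmu.2
  -- By injectivity of C, the curve exponents of the generator are b + c, hence at least b. Negative
  -- entries of b become 0 under `toNat` and impose nothing.
  rw [← D.cartan_mulVec_sum, ← Matrix.mulVec_sub, ← sub_eq_zero, ← Matrix.mulVec_sub] at hc
  have hj := congrFun (D.cartan_injective _ hc) j
  simp only [Pi.sub_apply, Pi.zero_apply] at hj
  refine pow_curveEq_dvd _ j _ _ (fun d hd => ?_) (D.pullback_prod n)
  rw [coordMonomial_eq_monomial, C_mul_monomial] at hd
  have := support_monomial_subset hd
  rw [Finset.mem_singleton] at this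
  subst this
  rw [coordExponent_inr]
  omega

/-- This makes the matrix inverse in `quiver` a genuine inverse over ℚ rather than the default value
0. -/
theorem isUnit_det (D : MonomialModel g) : IsUnit (g.cartan.map (Int.cast : ℤ → ℚ)).det := by
  have h : g.cartan.det ≠ 0 := by
    intro h
    obtain ⟨v, hv, h0⟩ := Matrix.exists_mulVec_eq_zero_iff.2 h
    exact hv (D.cartan_injective v h0)
  have h' : (g.cartan.map (Int.cast : ℤ → ℚ)).det = ((g.cartan.det : ℤ) : ℚ) :=
    (RingHom.map_det (Int.castRingHom ℚ) g.cartan).symm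
  rw [h', isUnit_iff_ne_zero]
  exact_mod_cast h

/-- The proposition for a type with a monomial model. -/
theorem exists_isLambdaOf (D : MonomialModel g) (P : MvPolynomial (Fin 3) ℂ)
    (hP : P ∉ Ideal.span {g.duVal}) :
    ∃ lam : g.Coweight, g.IsLambdaOf P lam ∧ g.RealizesQuiver P (g.quiver lam) := by
  have := D.isDomain
  have hne : g.pullback P ≠ 0 := fun h0 => hP (Ideal.mem_span_singleton.2 (D.duVal_dvd P
    (Ideal.mem_span_singleton.1 (Ideal.Quotient.eq_zero_iff_mem.1 h0))))
  have hfin : ∀ j, FiniteMultiplicity (g.curveEq j) (g.pullback P) := fun j =>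
    FiniteMultiplicity.of_prime_left (D.prime_curveEq j) hne
  set m : Fin g.rank → ℕ := fun j => multiplicity (g.curveEq j) (g.pullback P) with hm
  have hdvd : ∀ j n, g.curveEq j ^ n ∣ g.pullback P ↔ n ≤ m j := fun j n =>
    (hfin j).pow_dvd_iff_le_multiplicity
  obtain ⟨G, hG0, hGm, hPG⟩ := D.exists_support P m fun j => (hdvd j _).2 le_rfl
  have hdom : g.cartan.mulVec (fun j => (m j : ℤ)) ∈ g.dominantCoroot := by
    refine ⟨fun j => ?_, _, rfl⟩
    -- If every monomial had an exponent above `m j` at this node, the pull-back would be divisible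
    -- by one more power of e_j.
    obtain ⟨d, hd, hdj⟩ : ∃ d ∈ G.support, d (Sum.inr j) = m j := by
      by_contra! hcon
      have := (hdvd j (m j + 1)).1 (pow_curveEq_dvd P j _ G
        (fun d hd => lt_of_le_of_ne (hGm d hd j) (hcon d hd).symm) hPG)
      omega
    have h0 := hG0 d hd
    rw [weight_coordWeight, sub_eq_zero] at h0
    refine (endWeight_nonneg D.node (fun l => d (Sum.inl l)) j).trans ?_
    rw [h0]
    rw [Matrix.mulVec, Matrix.mulVec, dotProduct, dotProduct]
    -- The exponents of `d` and `m` agree at the node j; at other nodes that of `d` is at least as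
    -- large and the Cartan entry is nonpositive. So (C·m)_j is at least the end weight of `d` at j,
    -- which is nonnegative.
    refine Finset.sum_le_sum fun i _ => ?_
    by_cases hij : j = i
    · rw [← hij, hdj]
    · exact mul_le_mul_of_nonpos_left (by exact_mod_cast hGm d hd i) (D.cartan_nonpos j i hij)
  refine ⟨g.cartan.mulVec fun j => (m j : ℤ), ⟨⟨hdom, ?_⟩, ?_⟩, ?_, ?_⟩
  · obtain ⟨Q, hQ, hQG⟩ := D.exists_mem_idealTilde m G hG0 hGm
    have : Ideal.Quotient.mk (Ideal.span {g.duVal}) P = Ideal.Quotient.mk _ Q := by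
      rw [Ideal.Quotient.eq, Ideal.mem_span_singleton]
      refine D.duVal_dvd _ ?_
      have := dvd_sub hPG hQG
      rwa [sub_sub_sub_cancel_right, ← map_sub] at this
    rw [this]
    exact Ideal.mem_map_of_mem _ hQ
  · intro nu hnu
    obtain ⟨b, rfl⟩ := hnu.1.2
    have hb : ∀ j, (b j).toNat ≤ m j := fun j =>
      (hdvd j _).1 (D.pow_curveEq_dvd_of_mem_coweightSet P b hnu j)
    refine ⟨fun j => (m j - b j : ℤ).toNat, ?_⟩
    rw [← Matrix.mulVec_sub]
    congr 1
    ext j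
    have := hb j
    simp only [Pi.sub_apply]
    omega
  · have hgauge : (g.quiver (g.cartan.mulVec fun j => (m j : ℤ))).gauge = fun j => (m j : ℚ) := by
      have : (fun i => ((g.cartan.mulVec (fun j => (m j : ℤ)) i : ℤ) : ℚ)) =
          (g.cartan.map (Int.cast : ℤ → ℚ)).mulVec fun j => (m j : ℚ) := by
        ext i
        simp [Matrix.mulVec, dotProduct]
      rw [quiver, this, Matrix.mulVec_mulVec, Matrix.nonsing_inv_mul _ D.isUnit_det,
        Matrix.one_mulVec]
    intro j
    refine ⟨m j, ?_, by rw [hgauge]⟩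
    have : {n | VanishesToOrder (g.curveIdeal j) (g.pullback P) n} = Set.Iic (m j) := by
      ext n
      rw [Set.mem_ofPred_eq, D.vanishesToOrder_iff, hdvd, Set.mem_Iic]
    rw [IsVanishingOrder, this]
    exact isGreatest_Iic
  · intro i
    set lam := g.cartan.mulVec fun j => (m j : ℤ)
    have h : (g.cartan.map (Int.cast : ℤ → ℚ)).mulVec (g.quiver lam).gauge =
        fun i => (lam i : ℚ) := by
      rw [quiver, Matrix.mulVec_mulVec, Matrix.mul_nonsing_inv _ D.isUnit_det, Matrix.one_mulVec]
    have := congrFun h i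
    simp only [Matrix.mulVec, dotProduct, Matrix.map_apply] at this
    exact this.symm

end MonomialModel

/-! ### Functions on the Du Val singularities -/

/-- The hypothesis says that `f` does not involve the variable `v`. -/
theorem eval_restrictZero_eq {σ : Type*} [DecidableEq σ] (v : σ) (p : σ → ℂ) (c : ℂ)
    (f : MvPolynomial σ ℂ) (hf : restrictZero v f = f) :
    eval (Function.update p v c) f = eval p f := by
  have h : ∀ p' : σ → ℂ, eval p' f = eval (fun s => if s = v then 0 else p' s) f := by
    intro p'
    nth_rw 1 [← hf]
    rw [restrictZero, aeval_def, eval_eval₂, ← eval₂_id]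
    congr 1
    · ext
      simp
    · ext s
      split_ifs <;> simp
  rw [h, h p]
  congr 2
  ext s
  split_ifs with hs <;> simp [hs]

/-- A polynomial vanishing on a double cover `x² + q(y, z, …) = 0` is a multiple of the equation
of the double cover. -/
theorem dvd_of_forall_eval_eq_zero {σ : Type*} [DecidableEq σ] (v : σ) (q : MvPolynomial σ ℂ)
    (hq : restrictZero v q = q) (hq0 : q ≠ 0) (f : MvPolynomial σ ℂ)
    (hf : ∀ p : σ → ℂ, eval p (X v ^ 2 + q) = 0 → eval p f = 0) : X v ^ 2 + q ∣ f := by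
  -- Division with remainder by an equation monic of degree two in `X v`.
  obtain ⟨a, b, ha, hb, t, ht⟩ : ∃ a b : MvPolynomial σ ℂ, restrictZero v a = a ∧
      restrictZero v b = b ∧ X v ^ 2 + q ∣ f - (a + b * X v) := by
    clear hf
    induction f using MvPolynomial.induction_on with
    | C c => exact ⟨C c, 0, by simp [restrictZero], by simp, by simp⟩
    | add f f' hf hf' =>
      obtain ⟨a, b, ha, hb, t, ht⟩ := hf
      obtain ⟨a', b', ha', hb', t', ht'⟩ := hf'
      exact ⟨a + a', b + b', by rw [map_add, ha, ha'], by rw [map_add, hb, hb'], t + t',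
        by linear_combination ht + ht'⟩
    | mul_X f s hf =>
      obtain ⟨a, b, ha, hb, t, ht⟩ := hf
      by_cases hs : s = v
      · subst hs
        exact ⟨-(b * q), a, by rw [map_neg, map_mul, hb, hq], ha, t * X s + b,
          by linear_combination X s * ht⟩
      · have hX : restrictZero v (X s : MvPolynomial σ ℂ) = X s := by simp [restrictZero, hs]
        exact ⟨a * X s, b * X s, by rw [map_mul, ha, hX], by rw [map_mul, hb, hX], t * X s,
          by linear_combination X s * ht⟩
  -- Evaluating at both square roots ±x of −q gives a = 0 and bx = 0. Since the roots coincide where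
  -- q vanishes, only bq = −bx² = 0 is claimed, and q ≠ 0 as a polynomial then gives b = 0.
  have key : ∀ p : σ → ℂ, eval p a = 0 ∧ eval p (b * q) = 0 := by
    intro p
    obtain ⟨x, hx⟩ := IsAlgClosed.exists_pow_nat_eq (-eval p q) (n := 2) (by norm_num)
    have h : ∀ x : ℂ, x ^ 2 = -eval p q → eval p a + eval p b * x = 0 := by
      intro x hx
      have h0 : eval (Function.update p v x) (X v ^ 2 + q) = 0 := by
        rw [map_add, eval_restrictZero_eq v p x q hq]
        simp [hx]
      have h1 := congrArg (eval (Function.update p v x)) ht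
      simp only [map_sub, map_mul, h0, hf _ h0, map_add (eval (Function.update p v x)) a,
        eval_restrictZero_eq v p x a ha, eval_restrictZero_eq v p x b hb, eval_X,
        Function.update_self, zero_mul] at h1
      linear_combination -h1
    have h1 := h x hx
    have h2 := h (-x) (by rw [neg_sq, hx])
    refine ⟨by linear_combination (h1 + h2) / 2, ?_⟩
    rw [map_mul]
    linear_combination -x / 2 * (h1 - h2) + eval p b * hx
  have ha0 : a = 0 := MvPolynomial.funext fun p => by rw [(key p).1, map_zero]
  have hb0 : b = 0 := (mul_eq_zero.1 (MvPolynomial.funext fun p => by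
    rw [(key p).2, map_zero])).resolve_right hq0
  exact ⟨t, by rw [← ht, ha0, hb0]; ring⟩

/-- If every point of the singularity lifts to a zero of the equation in homogeneous coordinates, a
function with zero pull-back vanishes at all points, and a Nullstellensatz for the Du Val polynomial
concludes. -/
theorem duVal_dvd_of_lift (g : DuValType)
    (hY : ∀ f, (∀ p, eval p g.duVal = 0 → eval p f = 0) → g.duVal ∣ f)
    (hlift : ∀ p, eval p g.duVal = 0 → ∃ t, eval t g.properTransform = 0 ∧
      ∀ i, eval t (g.blowdown i) = p i) (f : MvPolynomial (Fin 3) ℂ)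
    (hf : g.properTransform ∣ aeval g.blowdown f) : g.duVal ∣ f := by
  refine hY f fun p hp => ?_
  obtain ⟨t, ht, htp⟩ := hlift p hp
  have h0 : eval t (aeval g.blowdown f) = 0 := by
    obtain ⟨q, hq⟩ := hf
    rw [hq, map_mul, ht, zero_mul]
  rw [← h0, aeval_def, eval_eval₂, ← eval₂_id]
  congr 1
  · ext
    simp
  · ext i
    exact (htp i).symm

/-- Points are always lifted with all curve coordinates equal to 1, which leaves a system in the two
or three end coordinates. -/
theorem eval_coordMonomial {k r : ℕ} (d : Fin k → ℂ) (a : Fin k → ℕ) (b : Fin r → ℕ) :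
    eval (Sum.elim d fun _ => 1) (coordMonomial a b) = ∏ l, d l ^ a l := by
  simp [coordMonomial]

/-! ### Trinomials in the homogeneous coordinates -/

theorem isWeightedHomogeneous_coordMonomial {k r : ℕ} (M : Matrix (Fin r) (Fin r) ℤ)
    (node : Fin k → Fin r) (a : Fin k → ℕ) (b : Fin r → ℕ) (τ : Fin r → ℤ)
    (h : endWeight node a = M.mulVec (fun j => (b j : ℤ)) + τ) :
    IsWeightedHomogeneous (coordWeight M node) (coordMonomial a b) τ := by
  rw [coordMonomial_eq_monomial]
  refine isWeightedHomogeneous_monomial _ _ _ ?_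
  rw [weight_coordWeight, sub_eq_iff_eq_add']
  exact h

theorem sum_C_mul_coordMonomial {k r : ℕ} (c : Fin 3 → ℂ) (a : Fin 3 → Fin k → ℕ)
    (b : Fin 3 → Fin r → ℕ) :
    ∑ l, monomial (coordExponent (a l) (b l)) (c l) =
      C (c 0) * coordMonomial (a 0) (b 0) + C (c 1) * coordMonomial (a 1) (b 1) +
        C (c 2) * coordMonomial (a 2) (b 2) := by
  simp [Fin.sum_univ_three, coordMonomial_eq_monomial, C_mul_monomial]

/-- Trinomials in the homogeneous coordinates. -/
theorem trinomial_spec {k r : ℕ} {h : MvPolynomial (Fin k ⊕ Fin r) ℂ} (c : Fin 3 → ℂ)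
    (a : Fin 3 → Fin k → ℕ) (b : Fin 3 → Fin r → ℕ) (hc : ∀ l, c l ≠ 0)
    (heq : h = C (c 0) * coordMonomial (a 0) (b 0) + C (c 1) * coordMonomial (a 1) (b 1) +
      C (c 2) * coordMonomial (a 2) (b 2))
    (u : Fin 3 → Fin k ⊕ Fin r) (hu : ∀ l, Sum.elim (a l) (b l) (u l) = 1)
    (hd : ∀ s, (Sum.elim (a 0) (b 0) s = 0 ∨ Sum.elim (a 1) (b 1) s = 0) ∧
      (Sum.elim (a 0) (b 0) s = 0 ∨ Sum.elim (a 2) (b 2) s = 0) ∧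
      (Sum.elim (a 1) (b 1) s = 0 ∨ Sum.elim (a 2) (b 2) s = 0))
    (M : Matrix (Fin r) (Fin r) ℤ) (node : Fin k → Fin r) (τ : Fin r → ℤ)
    (hw : ∀ l, endWeight node (a l) = M.mulVec (fun j => (b l j : ℤ)) + τ) :
    HasPrimeDivisors (Sum.inr : Fin r → Fin k ⊕ Fin r) h ∧
      IsWeightedHomogeneous (coordWeight M node) h τ := by
  have key : ∀ l, IsWeightedHomogeneous (coordWeight M node)
      (C (c l) * coordMonomial (a l) (b l)) τ := fun l => by
    simpa using (isWeightedHomogeneous_C (coordWeight M node) (c l)).mul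
      (isWeightedHomogeneous_coordMonomial M node _ _ τ (hw l))
  constructor
  · rw [heq, ← sum_C_mul_coordMonomial]
    refine hasPrimeDivisors_trinomial _ c hc _ u hu fun l l' s hl h => ?_
    change Sum.elim (a l) (b l) s ≠ 0 at h
    change Sum.elim (a l') (b l') s = 0
    obtain ⟨h01, h02, h12⟩ := hd s
    fin_cases l <;> fin_cases l' <;> first | exact absurd rfl hl | tauto
  · rw [heq]
    exact ((key 0).add (key 1)).add (key 2)

theorem C_inv_two_mul_two {σ : Type*} : (C (2⁻¹ : ℂ) : MvPolynomial σ ℂ) * 2 = 1 := by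
  have h : (2 : MvPolynomial σ ℂ) = C 2 := (map_ofNat C 2).symm
  rw [h, ← C_mul, inv_mul_cancel₀ two_ne_zero, C_1]

/-! ### Type `E₈` -/

/-- The common weight of the three terms is the fundamental coweight of the trivalent node (index
3). The variables of exponent one are the curve coordinates of its three neighbours. -/
theorem properTransform_E8_spec :
    HasPrimeDivisors Sum.inr E8.properTransform ∧
      IsWeightedHomogeneous (coordWeight E8.cartan (![0, 1, 7] : Fin 3 → Fin 8))
        E8.properTransform (fun t : Fin 8 => if t = 3 then 1 else 0) :=
  trinomial_spec ![1, 1, 1] ![![0, 2, 0], ![3, 0, 0], ![0, 0, 5]]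
    ![![0, 1, 0, 0, 0, 0, 0, 0], ![2, 0, 1, 0, 0, 0, 0, 0], ![0, 0, 0, 0, 1, 2, 3, 4]]
    (by intro l; fin_cases l <;> simp) (by simp [properTransform])
    ![Sum.inr 1, Sum.inr 2, Sum.inr 4] (by decide) (by decide) _ _ _ (by decide)

/-- The monomial model of type `E₈`. -/
noncomputable def modelE8 : MonomialModel E8 where
  node := (![0, 1, 7] : Fin 3 → Fin 8)
  endExp := (![![0, 1, 0], ![1, 0, 0], ![0, 0, 1]] : Fin 3 → Fin 3 → ℕ)
  curveExp := (![![5, 8, 10, 15, 12, 9, 6, 3], ![4, 5, 7, 10, 8, 6, 4, 2],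
    ![2, 3, 4, 6, 5, 4, 3, 2]] : Fin 3 → Fin 8 → ℕ)
  scalar := fun _ => 1
  scalar_ne_zero := fun _ => one_ne_zero
  hasPrimeDivisors := properTransform_E8_spec.1
  homogeneous := ⟨_, properTransform_E8_spec.2⟩
  pullback_distPoly := by
    intro i
    refine ⟨0, ?_⟩
    fin_cases i <;> simp [distPoly, blowdown]
  cartan_mulVec_curveExp := by decide
  endWeight_endExp := by decide
  exists_endExp_eq_sum := by
    intro a b _
    -- There is no congruence condition here: every end coordinate is the end part of a
    -- distinguished monomial.
    refine ⟨(![a 1, a 0, a 2] : Fin 3 → ℕ), ?_⟩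
    ext (l : Fin 3)
    fin_cases l <;> simp [Fin.sum_univ_three]
  cartan_injective := by
    intro b hb
    exact Matrix.eq_zero_of_mulVec_eq_zero (by
      rw [cartan, CartanMatrix.E₈_det]; norm_num) hb
  cartan_nonpos := fun i j hij => CartanMatrix.E₈_off_diag_nonpos i j hij
  X_mem_range := by
    intro t
    refine ⟨X t, ?_⟩
    fin_cases t <;> simp [distPoly]
  dvd_duVal := by
    -- The common factor of the pull-backs of x², y³ and z⁵.
    refine ⟨coordMonomial ![0, 0, 0] ![10, 15, 20, 30, 24, 18, 12, 6], ?_⟩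
    simp [duVal, properTransform, blowdown, coordMonomial, Fin.prod_univ_succ]
    ring
  duVal_dvd := by
    refine duVal_dvd_of_lift E8 ?_ ?_
    · have := dvd_of_forall_eval_eq_zero (0 : Fin 3) (X 1 ^ 3 + X 2 ^ 5)
        (by simp [restrictZero]) (fun h => by
          have := congrArg (eval ![0, 1, 0]) h
          simp at this)
      rw [← add_assoc] at this
      exact this
    · intro p hp
      refine ⟨Sum.elim ![p 1, p 0, p 2] fun _ => 1, ?_, ?_⟩
      · simpa [properTransform, eval_coordMonomial, Fin.prod_univ_three, duVal] using hp
      · intro i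
        fin_cases i <;> simp [blowdown, eval_coordMonomial, Fin.prod_univ_three]

/-! ### Type `E₇` -/

theorem properTransform_E7_spec :
    HasPrimeDivisors Sum.inr E7.properTransform ∧
      IsWeightedHomogeneous (coordWeight E7.cartan (![0, 1, 6] : Fin 3 → Fin 7))
        E7.properTransform (fun t : Fin 7 => if t = 3 then 1 else 0) :=
  trinomial_spec ![1, 1, -1] ![![0, 0, 4], ![3, 0, 0], ![0, 2, 0]]
    ![![0, 0, 0, 0, 1, 2, 3], ![2, 0, 1, 0, 0, 0, 0], ![0, 1, 0, 0, 0, 0, 0]]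
    (by intro l; fin_cases l <;> simp) (by simp [properTransform, sub_eq_add_neg])
    ![Sum.inr 4, Sum.inr 2, Sum.inr 1] (by decide) (by decide) _ _ _ (by decide)

/-- The monomial model of type `E₇`. -/
noncomputable def modelE7 : MonomialModel E7 where
  node := (![0, 1, 6] : Fin 3 → Fin 7)
  endExp := (![![0, 1, 1], ![0, 0, 2], ![1, 0, 0], ![0, 2, 0]] : Fin 4 → Fin 3 → ℕ)
  curveExp := (![![3, 5, 6, 9, 7, 5, 3], ![2, 3, 4, 6, 5, 4, 3], ![2, 2, 3, 4, 3, 2, 1],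
    ![4, 7, 8, 12, 9, 6, 3]] : Fin 4 → Fin 7 → ℕ)
  scalar := (![Complex.I, 1, 1, 1] : Fin 4 → ℂ)
  scalar_ne_zero := by
    intro i
    fin_cases i <;> simp
  hasPrimeDivisors := properTransform_E7_spec.1
  homogeneous := ⟨_, properTransform_E7_spec.2⟩
  pullback_distPoly := by
    intro i
    fin_cases i
    · exact ⟨0, by simp [distPoly, blowdown]⟩
    · exact ⟨0, by simp [distPoly, blowdown]⟩
    · exact ⟨0, by simp [distPoly, blowdown]⟩
    · refine ⟨coordMonomial ![0, 0, 0] ![4, 6, 8, 12, 9, 6, 3], ?_⟩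
      simp [distPoly, properTransform, blowdown, coordMonomial, Fin.prod_univ_succ]
      ring
  cartan_mulVec_curveExp := by decide
  endWeight_endExp := by decide
  exists_endExp_eq_sum := by
    intro a b h
    have key : ((a : Fin 3 → ℕ) 1 + (a : Fin 3 → ℕ) 2) % 2 = 0 := by
      have h2 := congrFun h (1 : Fin 7)
      have h5 := congrFun h (4 : Fin 7)
      have h7 := congrFun h (6 : Fin 7)
      simp [endWeight, cartan, CartanMatrix.E₇, Matrix.mulVec, dotProduct, Fin.sum_univ_succ]
        at h2 h5 h7
      omega
    -- The exponents at nodes 2 and 7 have equal parity, so one factor x absorbs an odd pair and the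
    -- rest are squares.
    refine ⟨(![a 1 % 2, a 2 / 2, a 0, a 1 / 2] : Fin 4 → ℕ), ?_⟩
    ext (l : Fin 3)
    fin_cases l <;> simp [Fin.sum_univ_four] <;> omega
  cartan_injective := by
    intro b hb
    exact Matrix.eq_zero_of_mulVec_eq_zero (by
      rw [cartan, CartanMatrix.E₇_det]; norm_num) hb
  cartan_nonpos := fun i j hij => CartanMatrix.E₇_off_diag_nonpos i j hij
  X_mem_range := by
    intro t
    refine ⟨(![X 0, X 1, X 2] : Fin 3 → MvPolynomial (Fin 4) ℂ) t, ?_⟩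
    fin_cases t <;> simp [distPoly]
  dvd_duVal := by
    refine ⟨coordMonomial ![0, 0, 2] ![6, 9, 12, 18, 14, 10, 6], ?_⟩
    simp [duVal, properTransform, blowdown, coordMonomial, Fin.prod_univ_succ, mul_pow, ← C_pow]
    ring
  duVal_dvd := by
    refine duVal_dvd_of_lift E7 ?_ ?_
    · have := dvd_of_forall_eval_eq_zero (0 : Fin 3) (X 1 ^ 3 + X 1 * X 2 ^ 3)
        (by simp [restrictZero]) (fun h => by
          have := congrArg (eval ![0, 1, 0]) h
          simp at this)
      rw [← add_assoc] at this
      exact this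
    · intro p hp
      have hp' : p 0 ^ 2 + p 1 ^ 3 + p 1 * p 2 ^ 3 = 0 := by simpa [duVal] using hp
      obtain ⟨r, hr⟩ := IsAlgClosed.exists_pow_nat_eq (p 1) (n := 2) (by norm_num)
      -- For r ≠ 0 the value of q is forced by x = iqr. For r = 0 the equation gives x = y = 0, and
      -- any square root of z³ will do.
      obtain ⟨q, hq1, hq2⟩ : ∃ q, q ^ 2 = r ^ 4 + p 2 ^ 3 ∧ Complex.I * (q * r) = p 0 := by
        by_cases h0 : r = 0
        · obtain ⟨q, hq⟩ := IsAlgClosed.exists_pow_nat_eq (p 2 ^ 3) (n := 2) (by norm_num)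
          refine ⟨q, by rw [hq, h0]; ring, ?_⟩
          rw [← hr, h0] at hp'
          have : p 0 = 0 := by simpa using hp'
          rw [this, h0]
          ring
        · refine ⟨-Complex.I * p 0 / r, ?_, ?_⟩
          · field_simp
            rw [Complex.I_sq]
            rw [← hr] at hp'
            linear_combination -hp'
          · field_simp
            linear_combination -p 0 * Complex.I_sq
      refine ⟨Sum.elim ![p 2, q, r] fun _ => 1, ?_, ?_⟩
      · simp [properTransform, eval_coordMonomial, Fin.prod_univ_three]
        linear_combination -hq1
      · intro i
        fin_cases i <;> simp [blowdown, eval_coordMonomial, Fin.prod_univ_three, hr, hq2]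

/-! ### Type `E₆` -/

theorem properTransform_E6_spec :
    HasPrimeDivisors Sum.inr E6.properTransform ∧
      IsWeightedHomogeneous (coordWeight E6.cartan (![0, 1, 5] : Fin 3 → Fin 6))
        E6.properTransform (fun t : Fin 6 => if t = 3 then 1 else 0) :=
  trinomial_spec ![1, -1, -(2 * Complex.I)] ![![3, 0, 0], ![0, 0, 3], ![0, 2, 0]]
    ![![2, 0, 1, 0, 0, 0], ![0, 0, 0, 0, 1, 2], ![0, 1, 0, 0, 0, 0]]
    (by intro l; fin_cases l <;> simp) (by simp [properTransform, sub_eq_add_neg])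
    ![Sum.inr 2, Sum.inr 4, Sum.inr 1] (by decide) (by decide) _ _ _ (by decide)

/-- The monomial model of type `E₆`. -/
noncomputable def modelE6 : MonomialModel E6 where
  node := (![0, 1, 5] : Fin 3 → Fin 6)
  endExp := (![![1, 0, 1], ![0, 1, 0], ![3, 0, 0], ![0, 0, 3]] : Fin 4 → Fin 3 → ℕ)
  curveExp := (![![2, 2, 3, 4, 3, 2], ![1, 2, 2, 3, 2, 1], ![4, 3, 5, 6, 4, 2],
    ![2, 3, 4, 6, 5, 4]] : Fin 4 → Fin 6 → ℕ)
  scalar := (![-1, 1, 1, 1] : Fin 4 → ℂ)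
  scalar_ne_zero := by
    intro i
    fin_cases i <;> simp
  hasPrimeDivisors := properTransform_E6_spec.1
  homogeneous := ⟨_, properTransform_E6_spec.2⟩
  pullback_distPoly := by
    intro i
    fin_cases i
    · exact ⟨0, by simp [distPoly, blowdown]⟩
    · exact ⟨0, by simp [distPoly, blowdown]⟩
    · exact ⟨0, by simp [distPoly, blowdown]⟩
    · refine ⟨coordMonomial ![0, 0, 0] ![2, 3, 4, 6, 4, 2], ?_⟩
      simp [map_ofNat C, distPoly, properTransform, blowdown, coordMonomial, Fin.prod_univ_succ]
      ring
  cartan_mulVec_curveExp := by decide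
  endWeight_endExp := by decide
  exists_endExp_eq_sum := by
    intro a b h
    have key : ((a : Fin 3 → ℕ) 0 + 2 * (a : Fin 3 → ℕ) 2) % 3 = 0 := by
      have h1 := congrFun h (0 : Fin 6)
      have h2 := congrFun h (1 : Fin 6)
      have h3 := congrFun h (2 : Fin 6)
      have h4 := congrFun h (3 : Fin 6)
      have h5 := congrFun h (4 : Fin 6)
      have h6 := congrFun h (5 : Fin 6)
      simp [endWeight, cartan, CartanMatrix.E₆, Matrix.mulVec, dotProduct, Fin.sum_univ_succ]
        at h1 h2 h3 h4 h5 h6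
      omega
    -- The exponents at nodes 1 and 6 agree modulo 3; the common remainder is absorbed by powers of
    -- y.
    refine ⟨(![a 0 % 3, a 1, a 0 / 3, a 2 / 3] : Fin 4 → ℕ), ?_⟩
    ext (l : Fin 3)
    fin_cases l <;> simp [Fin.sum_univ_four] <;> omega
  cartan_injective := by
    intro b hb
    exact Matrix.eq_zero_of_mulVec_eq_zero (by
      rw [cartan, CartanMatrix.E₆_det]; norm_num) hb
  cartan_nonpos := fun i j hij => CartanMatrix.E₆_off_diag_nonpos i j hij
  X_mem_range := by
    intro t
    refine ⟨(![C 2⁻¹ * (X 2 + X 3), X 0, X 1] : Fin 3 → MvPolynomial (Fin 4) ℂ) t, ?_⟩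
    fin_cases t <;> simp [distPoly]
    linear_combination X 0 * C_inv_two_mul_two
  dvd_duVal := by
    -- From Y = (x + iz²)(x − iz²) + y³: this is the monomial of x + iz² times the common factor
    -- that occurs in the pull-back of x − iz².
    refine ⟨coordMonomial ![3, 0, 0] ![6, 6, 9, 12, 8, 4], ?_⟩
    have hI : (C Complex.I : MvPolynomial (Fin 3 ⊕ Fin 6) ℂ) ^ 2 = -1 := by
      rw [← C_pow, Complex.I_sq, C_neg, C_1]
    simp [map_ofNat C, duVal, properTransform, blowdown, coordMonomial, Fin.prod_univ_succ]
    linear_combination (X (Sum.inl 1) ^ 4 * X (Sum.inr 0) ^ 4 * X (Sum.inr 1) ^ 8 *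
      X (Sum.inr 2) ^ 8 * X (Sum.inr 3) ^ 12 * X (Sum.inr 4) ^ 8 * X (Sum.inr 5) ^ 4) * hI
  duVal_dvd := by
    refine duVal_dvd_of_lift E6 ?_ ?_
    · have := dvd_of_forall_eval_eq_zero (0 : Fin 3) (X 1 ^ 3 + X 2 ^ 4)
        (by simp [restrictZero]) (fun h => by
          have := congrArg (eval ![0, 1, 0]) h
          simp at this)
      rw [← add_assoc] at this
      exact this
    · intro t ht
      have ht' : t 0 ^ 2 + t 1 ^ 3 + t 2 ^ 4 = 0 := by simpa [duVal] using ht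
      obtain ⟨p, hp⟩ := IsAlgClosed.exists_pow_nat_eq (t 0 + Complex.I * t 2 ^ 2) (n := 3)
        (by norm_num)
      -- Here p and r are cube roots of x + iz² and x − iz², matched by y = −pr. If p = 0, then y =
      -- 0 and any cube root serves as r.
      obtain ⟨r, hr1, hr2⟩ : ∃ r, r ^ 3 = p ^ 3 - 2 * Complex.I * t 2 ^ 2 ∧ -(p * r) = t 1 := by
        by_cases h0 : p = 0
        · obtain ⟨r, hr⟩ := IsAlgClosed.exists_pow_nat_eq (-(2 * Complex.I * t 2 ^ 2)) (n := 3)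
            (by norm_num)
          refine ⟨r, by rw [hr, h0]; ring, ?_⟩
          have : t 1 ^ 3 = 0 := by
            linear_combination ht' + (t 0 - Complex.I * t 2 ^ 2) * (hp - h0 * p ^ 2)
              - t 2 ^ 4 * Complex.I_sq
          rw [pow_eq_zero_iff (by norm_num)] at this
          rw [this, h0]
          ring
        · refine ⟨-t 1 / p, ?_, ?_⟩
          · field_simp
            linear_combination -ht'
              - (p ^ 3 - 2 * Complex.I * t 2 ^ 2 + t 0 + Complex.I * t 2 ^ 2) * hp
              + t 2 ^ 4 * Complex.I_sq
          · field_simp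
      refine ⟨Sum.elim ![p, t 2, r] fun _ => 1, ?_, ?_⟩
      · simp [properTransform, eval_coordMonomial, Fin.prod_univ_three]
        linear_combination -hr1
      · intro i
        fin_cases i <;> simp [blowdown, eval_coordMonomial, Fin.prod_univ_three, hr2, hp]

/-! ### Chains -/

/-- The extension of a labelling of the nodes `1, …, n` by zero to all natural numbers. -/
def extendZero {n : ℕ} (b : Fin n → ℤ) (k : ℕ) : ℤ :=
  ∑ j : Fin n, if (j : ℕ) + 1 = k then b j else 0

theorem extendZero_succ {n : ℕ} (b : Fin n → ℤ) (i : Fin n) : extendZero b (i + 1) = b i := by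
  rw [extendZero, Finset.sum_eq_single i]
  · simp
  · intro j _ hj
    rw [if_neg]
    exact fun h => hj (Fin.ext (by omega))
  · simp

theorem extendZero_zero {n : ℕ} (b : Fin n → ℤ) : extendZero b 0 = 0 := by
  simp [extendZero]

theorem extendZero_of_lt {n : ℕ} (b : Fin n → ℤ) {k : ℕ} (hk : n < k) : extendZero b k = 0 := by
  refine Finset.sum_eq_zero fun j _ => if_neg ?_
  omega

theorem extendZero_eq {n : ℕ} (F : ℕ → ℤ) (k : ℕ) :
    extendZero (fun i : Fin n => F i) k = if 0 < k ∧ k ≤ n then F (k - 1) else 0 := by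
  split_ifs with h
  · obtain ⟨k, rfl⟩ : ∃ k', k = k' + 1 := ⟨k - 1, by omega⟩
    exact extendZero_succ (fun i : Fin n => F i) ⟨k, by omega⟩
  · rcases Nat.eq_zero_or_pos k with rfl | h0
    · exact extendZero_zero _
    · exact extendZero_of_lt _ (by omega)

theorem eq_zero_of_extendZero {n : ℕ} (b : Fin n → ℤ)
    (h : ∀ k, 0 < k → k ≤ n → extendZero b k = 0) : b = 0 := by
  ext i
  rw [← extendZero_succ b i, h _ (by omega) (by omega), Pi.zero_apply]

/-- A sequence with vanishing second differences is an arithmetic progression. -/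
theorem eq_add_mul_of_second_difference (β : ℕ → ℤ) (N : ℕ)
    (h : ∀ i < N, 2 * β (i + 1) - β i - β (i + 2) = 0) :
    ∀ k ≤ N + 1, β k = β 0 + k * (β 1 - β 0) := by
  intro k
  induction k using Nat.strong_induction_on with
  | _ k ih =>
    intro hk
    match k with
    | 0 => simp
    | 1 => simp
    | k + 2 =>
      have h1 := ih k (by omega) (by omega)
      have h2 := ih (k + 1) (by omega) (by omega)
      have h3 := h k (by omega)
      push_cast at *
      linear_combination 2 * h2 - h1 - h3

/-- With zeros at positions 0 and n + 1, the Cartan matrix is the negative second difference at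
every node, the two ends included. -/
theorem A_mulVec {n : ℕ} (b : Fin n → ℤ) (i : Fin n) :
    (CartanMatrix.A n).mulVec b i =
      2 * extendZero b (i + 1) - extendZero b i - extendZero b (i + 2) := by
  simp only [Matrix.mulVec, dotProduct, extendZero, Finset.mul_sum, ← Finset.sum_sub_distrib]
  refine Finset.sum_congr rfl fun j _ => ?_
  simp only [CartanMatrix.A, Matrix.of_apply, Fin.ext_iff]
  split_ifs <;> omega

/-! ### Type `A` -/

theorem A_mulVec_injective {n : ℕ} (b : Fin n → ℤ) (h : (CartanMatrix.A n).mulVec b = 0) :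
    b = 0 := by
  have key := eq_add_mul_of_second_difference (extendZero b) n fun i hi => by
    rw [← A_mulVec b ⟨i, hi⟩, h, Pi.zero_apply]
  rw [extendZero_zero] at key
  have h1 := key (n + 1) le_rfl
  rw [extendZero_of_lt b (by omega)] at h1
  have h2 : extendZero b 1 = 0 := by
    by_contra h2
    have : ((n : ℤ) + 1) * extendZero b 1 ≠ 0 := mul_ne_zero (by positivity) h2
    apply this
    push_cast at h1
    linear_combination -h1
  exact eq_zero_of_extendZero b fun k _ hk => by rw [key k (by omega), h2]; ring

/-- Putting a₀ at position 0 and a₁ at position n + 1 absorbs the right-hand side into the boundary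
values, and b becomes an arithmetic progression. Hence a₁ = a₀ + (n + 1)δ, and the sign of δ decides
whether powers of y or of x accompany those of z. -/
theorem A_exists_eq_sum {n : ℕ} (hn : 1 ≤ n) (a : Fin 2 → ℕ) (b : Fin n → ℕ)
    (h : (CartanMatrix.A n).mulVec (fun j => (b j : ℤ)) =
      endWeight ![⟨0, hn⟩, ⟨n - 1, by omega⟩] a) :
    ∃ c : Fin 3 → ℕ, a =
      ∑ i, c i • (![![n + 1, 0], ![0, n + 1], ![1, 1]] : Fin 3 → Fin 2 → ℕ) i := by
  set β := extendZero (fun j => (b j : ℤ)) with hβ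
  have key := eq_add_mul_of_second_difference
    (fun k => β k + (if k = 0 then (a 0 : ℤ) else 0) + if k = n + 1 then (a 1 : ℤ) else 0) n
    fun i hi => by
      have h1 := congrFun h ⟨i, hi⟩
      rw [A_mulVec, ← hβ] at h1
      simp only [endWeight, Fin.sum_univ_two, Matrix.cons_val_zero, Matrix.cons_val_one,
        Fin.mk.injEq] at h1
      split_ifs at h1 ⊢ <;> first | contradiction | omega
  have h1 := key (n + 1) le_rfl
  have h0 : β 0 = 0 := extendZero_zero _
  have hn1 : β (n + 1) = 0 := extendZero_of_lt _ (by omega)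
  have hn0 : ¬ 1 = n + 1 := by omega
  simp only [h0, hn1, hn0, if_true, if_false, Nat.succ_ne_zero, one_ne_zero, zero_add,
    add_zero, (Nat.succ_ne_zero n).symm, Nat.cast_add, Nat.cast_one] at h1
  set δ := β 1 - (a 0 : ℤ) with hδ
  rcases le_total 0 δ with hd | hd
  · refine ⟨![0, δ.toNat, a 0], ?_⟩
    have : (a 1 : ℤ) = ((δ.toNat * (n + 1) + a 0 : ℕ) : ℤ) := by
      push_cast
      rw [Int.toNat_of_nonneg hd]
      linear_combination h1
    ext l
    fin_cases l <;> simp [Fin.sum_univ_three]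
    exact_mod_cast this
  · refine ⟨![(-δ).toNat, 0, a 1], ?_⟩
    have : (a 0 : ℤ) = (((-δ).toNat * (n + 1) + a 1 : ℕ) : ℤ) := by
      push_cast
      rw [Int.toNat_of_nonneg (by omega)]
      linear_combination -h1
    ext l
    fin_cases l <;> simp [Fin.sum_univ_three]
    exact_mod_cast this

/-- The polynomial has degree one in x with coprime coefficients, so it is irreducible and the
Nullstellensatz for prime ideals applies. -/
theorem A_dvd_of_forall_eval (n : ℕ) (f : MvPolynomial (Fin 3) ℂ)
    (hf : ∀ p, eval p (X 0 * X 1 + X 2 ^ (n + 1) : MvPolynomial (Fin 3) ℂ) = 0 → eval p f = 0) :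
    X 0 * X 1 + X 2 ^ (n + 1) ∣ f := by
  have hirr : Irreducible (X 0 * X 1 + X 2 ^ (n + 1) : MvPolynomial (Fin 3) ℂ) := by
    rw [mul_comm]
    refine irreducible_mul_X_add _ _ _ (X_ne_zero _) (by simp [vars_X]) (fun h => ?_) ?_
    · have := vars_pow _ _ h
      simp [vars_X] at this
    · refine IsRelPrime.pow_right ?_
      rw [X_prime.irreducible.isRelPrime_iff_not_dvd, X_dvd_X]
      decide
  have := (Ideal.span_singleton_prime hirr.ne_zero).2 hirr.prime
  rw [← Ideal.mem_span_singleton, ← IsPrime.vanishingIdeal_zeroLocus (K := ℂ) (Ideal.span _),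
    mem_vanishingIdeal_iff]
  intro p hp
  rw [zeroLocus_span] at hp
  have := hf p (by simpa [aeval_eq_eval] using hp)
  simpa [aeval_eq_eval] using this

/-- The monomial model of type `A`. -/
noncomputable def modelA (n : ℕ) (hn : 1 ≤ n) : MonomialModel (A n hn) where
  node := (![⟨0, hn⟩, ⟨n - 1, by omega⟩] : Fin 2 → Fin n)
  endExp := (![![n + 1, 0], ![0, n + 1], ![1, 1]] : Fin 3 → Fin 2 → ℕ)
  curveExp := (![fun i => n - (i : ℕ), fun i => (i : ℕ) + 1, fun _ => 1] : Fin 3 → Fin n → ℕ)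
  scalar := (![1, -1, 1] : Fin 3 → ℂ)
  scalar_ne_zero := by
    intro i
    fin_cases i <;> simp
  hasPrimeDivisors := hasPrimeDivisors_zero _
  homogeneous := ⟨0, isWeightedHomogeneous_zero _ _ _⟩
  pullback_distPoly := by
    intro i
    refine ⟨0, ?_⟩
    fin_cases i <;> simp [distPoly, blowdown]
  cartan_mulVec_curveExp := by
    intro i
    ext (t : Fin n)
    refine (A_mulVec _ t).trans ?_
    fin_cases i
    · refine (congrArg₂ _ (congrArg₂ _ (congrArg _ (extendZero_eq (fun i => ((n - i : ℕ) : ℤ)) _))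
        (extendZero_eq (fun i => ((n - i : ℕ) : ℤ)) _))
        (extendZero_eq (fun i => ((n - i : ℕ) : ℤ)) _)).trans ?_
      simp [distCoweight, fundCoweight]
      split_ifs <;> omega
    · refine (congrArg₂ _ (congrArg₂ _ (congrArg _ (extendZero_eq (fun i => ((i + 1 : ℕ) : ℤ)) _))
        (extendZero_eq (fun i => ((i + 1 : ℕ) : ℤ)) _))
        (extendZero_eq (fun i => ((i + 1 : ℕ) : ℤ)) _)).trans ?_
      simp [distCoweight, fundCoweight]
      split_ifs <;> omega
    · refine (congrArg₂ _ (congrArg₂ _ (congrArg _ (extendZero_eq (fun i => 1) _))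
        (extendZero_eq (fun i => 1) _))
        (extendZero_eq (fun i => 1) _)).trans ?_
      simp [distCoweight, fundCoweight]
      split_ifs <;> omega
  endWeight_endExp := by
    intro i
    ext (t : Fin n)
    fin_cases i <;> simp [endWeight, distCoweight, fundCoweight, Fin.ext_iff] <;>
      split_ifs <;> omega
  exists_endExp_eq_sum := A_exists_eq_sum hn
  cartan_injective := A_mulVec_injective
  cartan_nonpos := CartanMatrix.A_apply_le_zero_of_ne n
  X_mem_range := by
    intro t
    refine ⟨X t, ?_⟩
    fin_cases t <;> simp [distPoly]
  dvd_duVal := by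
    -- The equation is zero in type `A`, so the pull-back of Y has to vanish identically.
    refine ⟨0, ?_⟩
    simp [duVal, blowdown, coordMonomial_mul, coordMonomial_pow]
    rw [neg_add_eq_zero]
    congr 1
    ext i
    simp
    omega
  duVal_dvd := by
    refine duVal_dvd_of_lift (A n hn) (A_dvd_of_forall_eval n) fun t ht => ?_
    have ht' : t 0 * t 1 + t 2 ^ (n + 1) = 0 := by simpa [duVal] using ht
    obtain ⟨p, hp⟩ := IsAlgClosed.exists_pow_nat_eq (t 0) (n := n + 1) (by omega)
    -- For p ≠ 0 take q = z/p. For p = 0 both x and z vanish, and any (n + 1)-st root of −y works.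
    obtain ⟨q, hq1, hq2⟩ : ∃ q, -q ^ (n + 1) = t 1 ∧ p * q = t 2 := by
      by_cases h0 : p = 0
      · obtain ⟨q, hq⟩ := IsAlgClosed.exists_pow_nat_eq (-t 1) (n := n + 1) (by omega)
        refine ⟨q, by rw [hq, neg_neg], ?_⟩
        have : t 2 ^ (n + 1) = 0 := by
          rw [h0, zero_pow (by omega)] at hp
          rw [← hp] at ht'
          simpa using ht'
        rw [h0, zero_mul, (pow_eq_zero_iff (by omega)).1 this]
      · refine ⟨t 2 / p, ?_, mul_div_cancel₀ _ h0⟩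
        have h0' : t 0 ≠ 0 := hp ▸ pow_ne_zero _ h0
        rw [div_pow, hp]
        field_simp
        linear_combination -ht'
    refine ⟨Sum.elim ![p, q] fun _ => 1, map_zero _, ?_⟩
    intro i
    fin_cases i <;> simp [blowdown, eval_coordMonomial, hp, hq1, hq2]

/-! ### Type `D`: combinatorics -/

theorem D_mulVec {n : ℕ} (hn : 4 ≤ n) (b : Fin n → ℤ) (i : Fin n) :
    (CartanMatrix.D n).mulVec b i =
      if (i : ℕ) + 3 < n then 2 * extendZero b (i + 1) - extendZero b i - extendZero b (i + 2)
      else if (i : ℕ) + 3 = n then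
        2 * extendZero b (i + 1) - extendZero b i - extendZero b (i + 2) - extendZero b (i + 3)
      else 2 * extendZero b (i + 1) - extendZero b (n - 2) := by
  split_ifs
  all_goals
    simp only [Matrix.mulVec, dotProduct, extendZero, Finset.mul_sum, ← Finset.sum_sub_distrib]
    refine Finset.sum_congr rfl fun j _ => ?_
    have hj := j.2
    have hi := i.2
    simp only [CartanMatrix.D, Matrix.of_apply, Fin.ext_iff]
    split_ifs <;> omega

/-- The nodes at the ends of the Dynkin diagram of type `D`. -/
def nodeD {n : ℕ} (hn : 4 ≤ n) : Fin 3 → Fin n :=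
  ![⟨0, by omega⟩, ⟨n - 2, by omega⟩, ⟨n - 1, by omega⟩]

theorem endWeight_nodeD {n : ℕ} (hn : 4 ≤ n) (a : Fin 3 → ℕ) (t : Fin n) :
    endWeight (nodeD hn) a t = (if (t : ℕ) = 0 then (a 0 : ℤ) else 0) +
      (if (t : ℕ) + 2 = n then (a 1 : ℤ) else 0) + if (t : ℕ) + 1 = n then (a 2 : ℤ) else 0 := by
  have ht := t.2
  simp only [endWeight, nodeD, Fin.sum_univ_three, Fin.ext_iff, Matrix.cons_val_zero,
    Matrix.cons_val_one, Matrix.cons_val]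
  congr 1
  · congr 1 <;> refine if_congr ?_ rfl rfl <;> omega
  · refine if_congr ?_ rfl rfl
    omega

/-- Along the chain up to the trivalent node, b is an arithmetic progression starting from a₀ at
position 0, with step δ. The two short ends express their values through that of the trivalent node,
and the equation at this node then gives a₁ + a₂ = 2δ. -/
theorem D_mulVec_eq_endWeight {n : ℕ} (hn : 4 ≤ n) (a : Fin 3 → ℕ) (b : Fin n → ℤ)
    (h : (CartanMatrix.D n).mulVec b = endWeight (nodeD hn) a) :
    ∃ δ : ℤ, (∀ k, 0 < k → k ≤ n - 2 → extendZero b k = a 0 + k * δ) ∧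
      2 * extendZero b (n - 1) = a 0 + (n - 2) * δ + a 1 ∧
      2 * extendZero b n = a 0 + (n - 2) * δ + a 2 ∧ (a 1 : ℤ) + a 2 = 2 * δ := by
  set β := extendZero b with hβ
  have h0 : β 0 = 0 := extendZero_zero _
  have hD : ∀ (i : ℕ) (hi : i < n), _ := fun i hi =>
    (D_mulVec hn b ⟨i, hi⟩).symm.trans ((congrFun h ⟨i, hi⟩).trans (endWeight_nodeD hn a _))
  simp only [← hβ] at hD
  have key := eq_add_mul_of_second_difference
    (fun k => β k + if k = 0 then (a 0 : ℤ) else 0) (n - 3) fun i hi => by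
      have h1 := hD i (by omega)
      rw [if_pos (by omega), if_neg (by omega : ¬ i + 2 = n), if_neg (by omega : ¬ i + 1 = n)] at h1
      split_ifs at h1 ⊢ <;> first | contradiction | omega
  obtain ⟨m, rfl⟩ : ∃ m, n = m + 4 := ⟨n - 4, by omega⟩
  simp only [h0, if_true, zero_add, one_ne_zero, if_false, add_zero] at key
  have h1 := hD (m + 1) (by omega)
  have h2 := hD (m + 2) (by omega)
  have h3 := hD (m + 3) (by omega)
  have k1 := key (m + 1) (by omega)
  have k2 := key (m + 2) (by omega)
  simp only [show m + 4 - 1 = m + 3 from rfl, show m + 4 - 2 = m + 2 from rfl] at h1 h2 h3 ⊢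
  simp at h1 h2 h3 k1 k2
  refine ⟨β 1 - a 0, fun k hk hk' => ?_, ?_, ?_, ?_⟩
  · have := key k (by omega)
    rwa [if_neg (by omega), add_zero] at this
  · push_cast
    linear_combination h2 + k2
  · push_cast
    linear_combination h3 + k2
  · linear_combination -2 * h1 + 2 * k2 - 2 * k1 - h2 - h3

theorem D_mulVec_injective {n : ℕ} (hn : 4 ≤ n) (b : Fin n → ℤ)
    (h : (CartanMatrix.D n).mulVec b = 0) : b = 0 := by
  obtain ⟨δ, h1, h2, h3, h4⟩ := D_mulVec_eq_endWeight hn 0 b (by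
    rw [h]
    ext t
    simp [endWeight])
  obtain rfl : δ = 0 := by simpa using h4
  simp only [Pi.zero_apply, Nat.cast_zero, mul_zero, add_zero, mul_eq_zero,
    two_ne_zero, false_or] at h1 h2 h3
  refine eq_zero_of_extendZero b fun k hk hk' => ?_
  rcases (by omega : k ≤ n - 2 ∨ k = n - 1 ∨ k = n) with hk | rfl | rfl
  · exact h1 k ‹_› hk
  · exact h2
  · exact h3

/-- Since n − 2 is even, the equations at the two short ends force a₀, a₁, a₂ to have the same
parity; one factor x absorbs odd exponents. -/
theorem Deven_exists_eq_sum {j : ℕ} (hj : 2 ≤ j) (a : Fin 3 → ℕ) (b : Fin (2 * j) → ℕ)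
    (h : (CartanMatrix.D (2 * j)).mulVec (fun i => (b i : ℤ)) =
      endWeight (nodeD (by omega)) a) :
    ∃ c : Fin 4 → ℕ, a = ∑ i, c i •
      (![![1, 1, 1], ![2, 0, 0], ![0, 2, 0], ![0, 0, 2]] : Fin 4 → Fin 3 → ℕ) i := by
  obtain ⟨δ, -, h1, h2, h3⟩ := D_mulVec_eq_endWeight (by omega) a _ h
  push_cast at h1
  -- Naming the product makes the remaining arithmetic linear.
  obtain ⟨w, hw⟩ : ∃ w : ℤ, w = (j - 1) * δ := ⟨_, rfl⟩
  have h4 : 2 * extendZero (fun i => (b i : ℤ)) (2 * j - 1) = a 0 + 2 * w + a 1 := by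
    rw [h1, hw]
    ring
  refine ⟨![a 0 % 2, a 0 / 2, a 1 / 2, a 2 / 2], ?_⟩
  ext l
  fin_cases l <;> simp [Fin.sum_univ_four] <;> omega

/-- Since n − 2 is odd, a₀ + a₁ + δ is even; with a₁ + a₂ = 2δ this gives a₂ − a₁ ≡ 2a₀ modulo 4.
After removing min(a₁, a₂) factors y, the excess at one short end is a multiple of 4, plus 2 when a₀
is odd. -/
theorem Dodd_exists_eq_sum {j : ℕ} (hj : 2 ≤ j) (a : Fin 3 → ℕ) (b : Fin (2 * j + 1) → ℕ)
    (h : (CartanMatrix.D (2 * j + 1)).mulVec (fun i => (b i : ℤ)) =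
      endWeight (nodeD (by omega)) a) :
    ∃ c : Fin 6 → ℕ, a = ∑ i, c i •
      (![![0, 1, 1], ![2, 0, 0], ![1, 0, 2], ![1, 2, 0], ![0, 0, 4], ![0, 4, 0]] :
        Fin 6 → Fin 3 → ℕ) i := by
  obtain ⟨δ, -, h1, h2, h3⟩ := D_mulVec_eq_endWeight (by omega) a _ h
  push_cast at h1
  obtain ⟨w, hw⟩ : ∃ w : ℤ, w = (j - 1) * δ := ⟨_, rfl⟩
  have h4 : 2 * extendZero (fun i => (b i : ℤ)) (2 * j) = a 0 + 2 * w + δ + a 1 := by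
    rw [hw]
    linear_combination h1
  rcases le_total (a 1) (a 2) with hle | hle
  · refine ⟨![a 1, a 0 / 2, a 0 % 2, 0, (a 2 - a 1) / 4, 0], ?_⟩
    ext l
    fin_cases l <;> simp [Fin.sum_univ_six] <;> omega
  · refine ⟨![a 2, a 0 / 2, 0, a 0 % 2, 0, (a 1 - a 2) / 4], ?_⟩
    ext l
    fin_cases l <;> simp [Fin.sum_univ_six] <;> omega

theorem D_mulVec_nat {n : ℕ} (hn : 4 ≤ n) (F : ℕ → ℕ) (t : Fin n) :
    (CartanMatrix.D n).mulVec (fun i => (F i : ℤ)) t =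
      if (t : ℕ) = 0 then 2 * (F 0 : ℤ) - F 1
      else if (t : ℕ) + 3 < n then 2 * (F t : ℤ) - F (t - 1) - F (t + 1)
      else if (t : ℕ) + 3 = n then 2 * (F t : ℤ) - F (t - 1) - F (t + 1) - F (t + 2)
      else 2 * (F t : ℤ) - F (n - 3) := by
  have ht := t.2
  rw [D_mulVec hn, extendZero_eq (fun i => (F i : ℤ)), extendZero_eq (fun i => (F i : ℤ)),
    extendZero_eq (fun i => (F i : ℤ)), extendZero_eq (fun i => (F i : ℤ)),
    extendZero_eq (fun i => (F i : ℤ))]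
  obtain ⟨t, -⟩ := t
  rcases Nat.eq_zero_or_pos t with rfl | h0
  · simp [show 3 < n by omega, show 2 ≤ n by omega, show n ≠ 0 by omega]
  · simp only [show t ≠ 0 by omega, if_false, Nat.add_sub_cancel, show t + 1 ≤ n by omega,
      show t ≤ n by omega, h0, Nat.succ_pos, and_self, if_true, show 0 < t + 2 by omega,
      show 0 < t + 3 by omega, true_and, show n - 2 - 1 = n - 3 by omega, show 0 < n - 2 by omega,
      show n - 2 ≤ n by omega, show t + 2 - 1 = t + 1 by omega, show t + 3 - 1 = t + 2 by omega]
    split_ifs <;> omega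

/-- The common weight is the fundamental coweight of the trivalent node n − 2, and the variables of
exponent one belong to its neighbours. Truncated subtraction makes the curve exponents of the last
term vanish at the nodes n − 2, n − 1 and n. -/
theorem properTransform_D_spec {n : ℕ} (hn : 4 ≤ n) :
    HasPrimeDivisors Sum.inr
      (coordMonomial ![0, 2, 0] (fun i => if (i : ℕ) + 1 = n - 1 then 1 else 0)
        - coordMonomial ![0, 0, 2] (fun i => if (i : ℕ) + 1 = n then 1 else 0)
        - C (2 * Complex.I) * coordMonomial ![n - 2, 0, 0] (fun i => n - 2 - ((i : ℕ) + 1)) :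
        MvPolynomial (Fin 3 ⊕ Fin n) ℂ) ∧
      IsWeightedHomogeneous (coordWeight (CartanMatrix.D n) (nodeD hn))
      (coordMonomial ![0, 2, 0] (fun i => if (i : ℕ) + 1 = n - 1 then 1 else 0)
        - coordMonomial ![0, 0, 2] (fun i => if (i : ℕ) + 1 = n then 1 else 0)
        - C (2 * Complex.I) * coordMonomial ![n - 2, 0, 0] (fun i => n - 2 - ((i : ℕ) + 1)) :
        MvPolynomial (Fin 3 ⊕ Fin n) ℂ) (fun t => if (t : ℕ) + 3 = n then 1 else 0) := by
  refine trinomial_spec ![1, -1, -(2 * Complex.I)] ![![0, 2, 0], ![0, 0, 2], ![n - 2, 0, 0]]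
    ![fun i => if (i : ℕ) + 1 = n - 1 then 1 else 0, fun i => if (i : ℕ) + 1 = n then 1 else 0,
      fun i => n - 2 - ((i : ℕ) + 1)] ?_ ?_
    ![Sum.inr ⟨n - 2, by omega⟩, Sum.inr ⟨n - 1, by omega⟩, Sum.inr ⟨n - 4, by omega⟩] ?_ ?_ _ _ _
    ?_
  · intro l
    fin_cases l <;> simp
  · simp [sub_eq_add_neg]
  · intro l
    fin_cases l <;> simp <;> omega
  · rintro (s | s)
    · fin_cases s <;> simp
    · simp only [Sum.elim_inr, Matrix.cons_val_zero, Matrix.cons_val_one, Matrix.cons_val]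
      split_ifs <;> omega
  · intro l
    ext t
    rw [Pi.add_apply, endWeight_nodeD]
    have ht := t.2
    fin_cases l
    · refine Eq.trans ?_ (congrArg (· + _)
        (D_mulVec_nat hn (fun i => if i + 1 = n - 1 then 1 else 0) t).symm)
      simp
      split_ifs <;> omega
    · refine Eq.trans ?_ (congrArg (· + _)
        (D_mulVec_nat hn (fun i => if i + 1 = n then 1 else 0) t).symm)
      simp
      split_ifs <;> omega
    · refine Eq.trans ?_ (congrArg (· + _)
        (D_mulVec_nat hn (fun i => n - 2 - (i + 1)) t).symm)
      simp
      split_ifs <;> omega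

theorem coordMonomial_congr {k r : ℕ} {a a' : Fin k → ℕ} {b b' : Fin r → ℕ} (ha : ∀ l, a l = a' l)
    (hb : ∀ i, b i = b' i) : coordMonomial a b = coordMonomial a' b' := by
  rw [_root_.funext ha, _root_.funext hb]

theorem D_dvd_of_forall_eval (n : ℕ) (f : MvPolynomial (Fin 3) ℂ)
    (hf : ∀ p, eval p (X 0 ^ 2 + X 2 * X 1 ^ 2 + X 2 ^ n : MvPolynomial (Fin 3) ℂ) = 0 →
      eval p f = 0) : X 0 ^ 2 + X 2 * X 1 ^ 2 + X 2 ^ n ∣ f := by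
  have := dvd_of_forall_eval_eq_zero (0 : Fin 3) (X 2 * X 1 ^ 2 + X 2 ^ n)
    (by simp [restrictZero]) (fun h => by
      have := congrArg (eval fun _ => 1) h
      norm_num at this)
  rw [← add_assoc] at this
  exact this f hf

/-! ### Type `D` with an even number of nodes -/

/-- The exponents of the curve coordinates: `f` along the chain, `p` and `q` at the two ends next to
the trivalent node. -/
def forkExp (n : ℕ) (f : ℕ → ℕ) (p q : ℕ) (i : ℕ) : ℕ :=
  if i + 1 ≤ n - 2 then f i else if i + 1 = n - 1 then p else q

/-- Once the monomials are named, what is needed about the blow-down follows from two relations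
among them, without further comparison of exponents. Here `x` is the monomial without the factor i,
and `m` is the common factor of the three terms of the last relation. -/
theorem Deven_monomials (j : ℕ) (hj : 2 ≤ j) :
    ∃ z w₃ w₄ x m : MvPolynomial (Fin 3 ⊕ Fin (2 * j)) ℂ,
      z = coordMonomial ![2, 0, 0] (fun i => forkExp (2 * j) (fun _ => 2) 1 1 i) ∧
      w₃ = coordMonomial ![0, 2, 0] (fun i => forkExp (2 * j) (fun i => i + 1) j (j - 1) i) ∧
      w₄ = coordMonomial ![0, 0, 2] (fun i => forkExp (2 * j) (fun i => i + 1) (j - 1) j i) ∧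
      x = coordMonomial ![1, 1, 1] (fun i => forkExp (2 * j) (fun i => i + 2) j j i) ∧
      (Deven j hj).blowdown = ![C Complex.I * x, w₃ - C Complex.I * z ^ (j - 1), z] ∧
      x ^ 2 = z * w₃ * w₄ ∧
      m * (Deven j hj).properTransform = w₃ - w₄ - 2 * C Complex.I * z ^ (j - 1) := by
  refine ⟨_, _, _, _, coordMonomial ![0, 0, 0]
    (fun i => forkExp (2 * j) (fun i => i + 1) (j - 1) (j - 1) i), rfl, rfl, rfl, rfl, ?_, ?_, ?_⟩
  · have h1 : (fun i : Fin (2 * j) => forkExp (2 * j) (fun _ => 2) 1 1 i) =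
        fun i : Fin (2 * j) => if (i : ℕ) + 1 ≤ 2 * j - 2 then 2 else 1 := by
      ext i
      simp [forkExp]
    have h2 : (fun i : Fin (2 * j) => forkExp (2 * j) (fun i => i + 2) j j i) =
        fun i : Fin (2 * j) => if (i : ℕ) + 1 ≤ 2 * j - 2 then (i : ℕ) + 2 else j := by
      ext i
      simp [forkExp]
    rw [h1, h2]
    rfl
  · simp only [coordMonomial_pow, coordMonomial_mul]
    refine coordMonomial_congr (fun l => ?_) (fun i => ?_)
    · fin_cases l <;> simp
    · simp [forkExp]
      split_ifs <;> omega
  · have e1 : coordMonomial ![0, 0, 0]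
        (fun i : Fin (2 * j) => forkExp (2 * j) (fun i => i + 1) (j - 1) (j - 1) i) *
        coordMonomial ![0, 2, 0] (fun i => if (i : ℕ) + 1 = 2 * j - 1 then 1 else 0) =
        coordMonomial ![0, 2, 0] (fun i => forkExp (2 * j) (fun i => i + 1) j (j - 1) i) := by
      rw [coordMonomial_mul]
      refine coordMonomial_congr (fun l => ?_) (fun i => ?_)
      · fin_cases l <;> simp
      · simp [forkExp]
        split_ifs <;> omega
    have e2 : coordMonomial ![0, 0, 0]
        (fun i : Fin (2 * j) => forkExp (2 * j) (fun i => i + 1) (j - 1) (j - 1) i) *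
        coordMonomial ![0, 0, 2] (fun i => if (i : ℕ) + 1 = 2 * j then 1 else 0) =
        coordMonomial ![0, 0, 2] (fun i => forkExp (2 * j) (fun i => i + 1) (j - 1) j i) := by
      rw [coordMonomial_mul]
      refine coordMonomial_congr (fun l => ?_) (fun i => ?_)
      · fin_cases l <;> simp
      · simp [forkExp]
        split_ifs <;> omega
    have e3 : coordMonomial ![0, 0, 0]
        (fun i : Fin (2 * j) => forkExp (2 * j) (fun i => i + 1) (j - 1) (j - 1) i) *
        coordMonomial ![2 * j - 2, 0, 0] (fun i => 2 * j - 2 - ((i : ℕ) + 1)) =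
        coordMonomial ![2, 0, 0] (fun i => forkExp (2 * j) (fun _ => 2) 1 1 i) ^ (j - 1) := by
      rw [coordMonomial_mul, coordMonomial_pow]
      refine coordMonomial_congr (fun l => ?_) (fun i => ?_)
      · fin_cases l <;> simp
        omega
      · simp [forkExp]
        split_ifs <;> omega
    have h2 : C (2 * Complex.I) =
        (2 * C Complex.I : MvPolynomial (Fin 3 ⊕ Fin (2 * j)) ℂ) := by
      rw [C_mul, map_ofNat C]
    simp only [properTransform, h2]
    linear_combination e1 - e2 - 2 * C Complex.I * e3

/-- The end coordinates are square roots of z, y + iz^{j−1} and y − iz^{j−1}, with signs matched by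
x = ipqr. If pq = 0, then x = 0 and the sign of r is free. -/
theorem Deven_lift (j : ℕ) (hj : 2 ≤ j) (x y z : ℂ)
    (h : x ^ 2 + z * y ^ 2 + z ^ (2 * j - 1) = 0) :
    ∃ p q r : ℂ, q ^ 2 - r ^ 2 = 2 * Complex.I * p ^ (2 * j - 2) ∧ p ^ 2 = z ∧
      q ^ 2 - Complex.I * z ^ (j - 1) = y ∧ Complex.I * (p * q * r) = x := by
  obtain ⟨p, hp⟩ := IsAlgClosed.exists_pow_nat_eq z (n := 2) (by norm_num)
  obtain ⟨q, hq⟩ := IsAlgClosed.exists_pow_nat_eq (y + Complex.I * z ^ (j - 1)) (n := 2)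
    (by norm_num)
  have hz : p ^ (2 * j - 2) = z ^ (j - 1) := by
    rw [← hp, ← pow_mul]
    congr 1
    omega
  have hz' : z ^ (2 * j - 1) = z * (z ^ (j - 1)) ^ 2 := by
    rw [← pow_mul, ← pow_succ']
    congr 1
    omega
  rw [hz'] at h
  generalize z ^ (j - 1) = Z at *
  have hx : x ^ 2 = -(p ^ 2 * q ^ 2 * (y - Complex.I * Z)) := by
    rw [hp, hq]
    linear_combination h + z * Z ^ 2 * (-Complex.I_sq)
  by_cases h0 : p * q = 0
  · obtain ⟨r, hr⟩ := IsAlgClosed.exists_pow_nat_eq (y - Complex.I * Z) (n := 2) (by norm_num)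
    refine ⟨p, q, r, by rw [hq, hr, hz]; ring, hp, by rw [hq]; ring, ?_⟩
    rw [← mul_pow, h0] at hx
    have : x = 0 := by simpa using hx
    rw [this, h0]
    ring
  · obtain ⟨hp0, hq0⟩ := mul_ne_zero_iff.1 h0
    have hr : (-Complex.I * x / (p * q)) ^ 2 = y - Complex.I * Z := by
      field_simp
      linear_combination x ^ 2 * Complex.I_sq - hx
    refine ⟨p, q, -Complex.I * x / (p * q), by rw [hq, hr, hz]; ring, hp, by rw [hq]; ring, ?_⟩
    field_simp
    linear_combination -x * Complex.I_sq

theorem D_mulVec_forkExp {n : ℕ} (hn : 4 ≤ n) (f : ℕ → ℕ) (p q : ℕ) (t : Fin n) :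
    (CartanMatrix.D n).mulVec (fun i => (forkExp n f p q i : ℤ)) t =
      if (t : ℕ) = 0 then 2 * (f 0 : ℤ) - f 1
      else if (t : ℕ) + 3 < n then 2 * (f t : ℤ) - f (t - 1) - f (t + 1)
      else if (t : ℕ) + 3 = n then 2 * (f t : ℤ) - f (t - 1) - p - q
      else if (t : ℕ) + 2 = n then 2 * (p : ℤ) - f (n - 3) else 2 * (q : ℤ) - f (n - 3) := by
  rw [D_mulVec_nat hn]
  have e : ∀ i, i + 1 ≤ n - 2 → forkExp n f p q i = f i := fun i hi => if_pos hi
  have e' : forkExp n f p q (n - 2) = p := by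
    rw [forkExp, if_neg (by omega), if_pos (by omega)]
  have e'' : forkExp n f p q (n - 1) = q := by
    rw [forkExp, if_neg (by omega), if_neg (by omega)]
  rw [e 0 (by omega), e 1 (by omega), e (n - 3) (by omega)]
  obtain ⟨t, ht⟩ := t
  dsimp only
  split_ifs with h1 h2 h3 h4
  · rfl
  · rw [e _ (by omega), e _ (by omega), e _ (by omega)]
  · rw [e _ (by omega), e _ (by omega), show t + 1 = n - 2 by omega, show t + 2 = n - 1 by omega,
      e',
      e'']
  · rw [show t = n - 2 by omega, e']
  · rw [show t = n - 1 by omega, e'']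

/-- The monomial model of type `D` with an even number of nodes. -/
noncomputable def modelDeven (j : ℕ) (hj : 2 ≤ j) : MonomialModel (Deven j hj) where
  node := (nodeD (by omega) : Fin 3 → Fin (2 * j))
  endExp := (![![1, 1, 1], ![2, 0, 0], ![0, 2, 0], ![0, 0, 2]] : Fin 4 → Fin 3 → ℕ)
  curveExp := (![fun i => forkExp (2 * j) (fun i => i + 2) j j i,
    fun i => forkExp (2 * j) (fun _ => 2) 1 1 i,
    fun i => forkExp (2 * j) (fun i => i + 1) j (j - 1) i,
    fun i => forkExp (2 * j) (fun i => i + 1) (j - 1) j i] : Fin 4 → Fin (2 * j) → ℕ)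
  scalar := (![Complex.I, 1, 1, 1] : Fin 4 → ℂ)
  scalar_ne_zero := by
    intro i
    fin_cases i <;> simp
  hasPrimeDivisors := (properTransform_D_spec (n := 2 * j) (by omega)).1
  homogeneous := ⟨_, (properTransform_D_spec (n := 2 * j) (by omega)).2⟩
  pullback_distPoly := by
    obtain ⟨z, w₃, w₄, x, m, hz, hw₃, hw₄, hx, hb, -, hm⟩ := Deven_monomials j hj
    have hI : (C Complex.I : MvPolynomial (Fin 3 ⊕ Fin (2 * j)) ℂ) =
      algebraMap ℂ (MvPolynomial (Fin 3 ⊕ Fin (2 * j)) ℂ) Complex.I := rfl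
    intro i
    rw [hb]
    fin_cases i
    · exact ⟨0, by simp [distPoly, ← hx]⟩
    · exact ⟨0, by simp [distPoly, ← hz]⟩
    · exact ⟨0, by simp [distPoly, ← hw₃, hI]⟩
    · refine Dvd.intro_left m (hm.trans ?_)
      simp [distPoly, ← hw₄, hI]
      ring
  cartan_mulVec_curveExp := by
    intro i
    ext (t : Fin (2 * j))
    have ht := t.2
    fin_cases i
    · refine (D_mulVec_forkExp (by omega) (fun i => i + 2) j j t).trans ?_
      simp [distCoweight, fundCoweight]
      split_ifs <;> omega
    · refine (D_mulVec_forkExp (by omega) (fun _ => 2) 1 1 t).trans ?_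
      simp [distCoweight, fundCoweight]
    · refine (D_mulVec_forkExp (by omega) (fun i => i + 1) j (j - 1) t).trans ?_
      simp [distCoweight, fundCoweight]
      split_ifs <;> omega
    · refine (D_mulVec_forkExp (by omega) (fun i => i + 1) (j - 1) j t).trans ?_
      simp [distCoweight, fundCoweight]
      split_ifs <;> omega
  endWeight_endExp := by
    intro i
    ext (t : Fin (2 * j))
    have ht := t.2
    refine (endWeight_nodeD (by omega) _ t).trans ?_
    fin_cases i
    all_goals
      simp [distCoweight, fundCoweight] <;> split_ifs <;> omega
  exists_endExp_eq_sum := Deven_exists_eq_sum hj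
  cartan_injective := D_mulVec_injective (n := 2 * j) (by omega)
  cartan_nonpos := CartanMatrix.D_off_diag_nonpos (2 * j)
  X_mem_range := by
    intro t
    refine ⟨(![X 0, C 2⁻¹ * (X 2 + X 3), X 1] : Fin 3 → MvPolynomial (Fin 4) ℂ) t, ?_⟩
    fin_cases t <;> simp [distPoly]
    linear_combination X 1 * C_inv_two_mul_two
  dvd_duVal := by
    obtain ⟨z, w₃, w₄, x, m, -, -, -, -, hb, hx, hm⟩ := Deven_monomials j hj
    -- The pull-back of Y is z·w₃·(−w₄ + w₃ − 2iz^{j−1}), and the last factor is `m` times the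
    -- equation.
    refine ⟨z * w₃ * m, ?_⟩
    have hI : (C Complex.I : MvPolynomial (Fin 3 ⊕ Fin (2 * j)) ℂ) ^ 2 = -1 := by
      rw [← C_pow, Complex.I_sq, C_neg, C_1]
    have hz' : z ^ (2 * j - 1) = z * (z ^ (j - 1)) ^ 2 := by
      rw [← pow_mul, ← pow_succ']
      congr 1
      omega
    rw [hb]
    simp [duVal]
    rw [hz']
    linear_combination (x ^ 2 + z * (z ^ (j - 1)) ^ 2) * hI - hx - z * w₃ * hm
  duVal_dvd := by
    refine duVal_dvd_of_lift (Deven j hj) (D_dvd_of_forall_eval _) fun t ht => ?_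
    obtain ⟨p, q, r, h1, h2, h3, h4⟩ := Deven_lift j hj (t 0) (t 1) (t 2)
      (by simpa [duVal] using ht)
    refine ⟨Sum.elim ![p, q, r] fun _ => 1, ?_, ?_⟩
    · simp [properTransform, eval_coordMonomial, Fin.prod_univ_three]
      linear_combination h1
    · intro i
      fin_cases i <;> simp [blowdown, eval_coordMonomial, Fin.prod_univ_three, h2, h3, h4]

/-! ### Type `D` with an odd number of nodes -/

/-- The monomials `y`, `w₅` and `w₆` lack the scalars i, −1 and −1 of the corresponding
distinguished polynomials. The last three relations are monomial multiples of the equation and give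
the pull-backs of the three polynomials that are monomials only modulo it. -/
theorem Dodd_monomials (j : ℕ) (hj : 2 ≤ j) :
    ∃ y z w₃ w₄ w₅ w₆ m₄ m₅ m₆ : MvPolynomial (Fin 3 ⊕ Fin (2 * j + 1)) ℂ,
      y = coordMonomial ![0, 1, 1] (fun i => forkExp (2 * j + 1) (fun i => i + 1) j j i) ∧
      z = coordMonomial ![2, 0, 0] (fun i => forkExp (2 * j + 1) (fun _ => 2) 1 1 i) ∧
      w₃ = coordMonomial ![1, 0, 2] (fun i => forkExp (2 * j + 1) (fun i => i + 2) j (j + 1) i) ∧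
      w₄ = coordMonomial ![1, 2, 0] (fun i => forkExp (2 * j + 1) (fun i => i + 2) (j + 1) j i) ∧
      w₅ = coordMonomial ![0, 0, 4]
        (fun i => forkExp (2 * j + 1) (fun i => 2 * (i + 1)) (2 * j - 1) (2 * j + 1) i) ∧
      w₆ = coordMonomial ![0, 4, 0]
        (fun i => forkExp (2 * j + 1) (fun i => 2 * (i + 1)) (2 * j + 1) (2 * j - 1) i) ∧
      (Dodd j hj).blowdown = ![w₃ + C Complex.I * z ^ j, C Complex.I * y, z] ∧
      w₃ * w₄ = z * y ^ 2 ∧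
      m₄ * (Dodd j hj).properTransform = w₄ - w₃ - 2 * C Complex.I * z ^ j ∧
      m₅ * (Dodd j hj).properTransform = y ^ 2 - w₅ - 2 * C Complex.I * (z ^ (j - 1) * w₃) ∧
      m₆ * (Dodd j hj).properTransform = w₆ - y ^ 2 - 2 * C Complex.I * (z ^ (j - 1) * w₄) := by
  have h2 : C (2 * Complex.I) =
      (2 * C Complex.I : MvPolynomial (Fin 3 ⊕ Fin (2 * j + 1)) ℂ) := by
    rw [C_mul, map_ofNat C]
  refine ⟨_, _, _, _, _, _, coordMonomial ![1, 0, 0]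
    (fun i => forkExp (2 * j + 1) (fun i => i + 2) j j i), coordMonomial ![0, 0, 2]
    (fun i => forkExp (2 * j + 1) (fun i => 2 * (i + 1)) (2 * j - 1) (2 * j) i),
    coordMonomial ![0, 2, 0]
    (fun i => forkExp (2 * j + 1) (fun i => 2 * (i + 1)) (2 * j) (2 * j - 1) i),
    rfl, rfl, rfl, rfl, rfl, rfl, ?_, ?_, ?_, ?_, ?_⟩
  · have h1 : (fun i : Fin (2 * j + 1) => forkExp (2 * j + 1) (fun _ => 2) 1 1 i) =
        fun i : Fin (2 * j + 1) => if (i : ℕ) + 1 ≤ 2 * j - 1 then 2 else 1 := by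
      ext i
      simp [forkExp]
    have h2 : (fun i : Fin (2 * j + 1) => forkExp (2 * j + 1) (fun i => i + 1) j j i) =
        fun i : Fin (2 * j + 1) => if (i : ℕ) + 1 ≤ 2 * j - 1 then (i : ℕ) + 1 else j := by
      ext i
      simp [forkExp]
    rw [h1, h2]
    rfl
  · simp only [coordMonomial_pow, coordMonomial_mul]
    refine coordMonomial_congr (fun l => ?_) (fun i => ?_)
    · fin_cases l <;> simp
    · simp [forkExp]
      split_ifs <;> omega
  · simp only [properTransform, h2, mul_sub, mul_left_comm _ (2 * C Complex.I), coordMonomial_mul,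
      coordMonomial_pow]
    refine congrArg₂ _ (congrArg₂ _ ?_ ?_) (congrArg _ ?_)
    all_goals refine coordMonomial_congr (fun l => ?_) (fun i => ?_)
    all_goals first
      | (fin_cases l <;> simp <;> omega)
      | (simp [forkExp]; split_ifs <;> omega)
  · simp only [properTransform, h2, mul_sub, mul_left_comm _ (2 * C Complex.I), coordMonomial_mul,
      coordMonomial_pow]
    refine congrArg₂ _ (congrArg₂ _ ?_ ?_) (congrArg _ ?_)
    all_goals refine coordMonomial_congr (fun l => ?_) (fun i => ?_)
    all_goals first
      | (fin_cases l <;> simp <;> omega)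
      | (simp [forkExp]; split_ifs <;> omega)
  · simp only [properTransform, h2, mul_sub, mul_left_comm _ (2 * C Complex.I), coordMonomial_mul,
      coordMonomial_pow]
    refine congrArg₂ _ (congrArg₂ _ ?_ ?_) (congrArg _ ?_)
    all_goals refine coordMonomial_congr (fun l => ?_) (fun i => ?_)
    all_goals first
      | (fin_cases l <;> simp <;> omega)
      | (simp [forkExp]; split_ifs <;> omega)

/-- Away from z = 0, the numbers pq² and pr² are x + iz^j and x − iz^j, with signs matched by y =
iqr; r = 0 forces y = 0. If z = 0, then x = 0 and q = r is a square root of −iy. -/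
theorem Dodd_lift (j : ℕ) (hj : 2 ≤ j) (x y z : ℂ)
    (h : x ^ 2 + z * y ^ 2 + z ^ (2 * j) = 0) :
    ∃ p q r : ℂ, q ^ 2 - r ^ 2 = 2 * Complex.I * p ^ (2 * j - 1) ∧ p ^ 2 = z ∧
      p * r ^ 2 + Complex.I * z ^ j = x ∧ Complex.I * (q * r) = y := by
  obtain ⟨p, hp⟩ := IsAlgClosed.exists_pow_nat_eq z (n := 2) (by norm_num)
  have hz : p * p ^ (2 * j - 1) = z ^ j := by
    rw [← hp, ← pow_mul, ← pow_succ']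
    congr 1
    omega
  have hz' : z ^ (2 * j) = (z ^ j) ^ 2 := by
    rw [← pow_mul, mul_comm]
  rw [hz'] at h
  by_cases hp0 : p = 0
  · have hz0 : z = 0 := by rw [← hp, hp0, zero_pow two_ne_zero]
    have hzj : z ^ j = 0 := by rw [hz0, zero_pow (by omega)]
    have hpj : p ^ (2 * j - 1) = 0 := by rw [hp0, zero_pow (by omega)]
    have hx : x = 0 := by
      rw [hzj, hz0] at h
      simpa using h
    obtain ⟨r, hr⟩ := IsAlgClosed.exists_pow_nat_eq (-Complex.I * y) (n := 2) (by norm_num)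
    refine ⟨p, r, r, by rw [hpj]; ring, hp, by rw [hzj, hp0, hx]; ring, ?_⟩
    linear_combination Complex.I * hr - y * Complex.I_sq
  · obtain ⟨r, hr⟩ := IsAlgClosed.exists_pow_nat_eq ((x - Complex.I * z ^ j) / p) (n := 2)
      (by norm_num)
    have hr' : p * r ^ 2 + Complex.I * z ^ j = x := by
      rw [hr]
      field_simp
      ring
    obtain ⟨q, hq, hqr⟩ : ∃ q, p * q ^ 2 = x + Complex.I * z ^ j ∧ Complex.I * (q * r) = y := by
      by_cases hr0 : r = 0
      · obtain ⟨q, hq⟩ := IsAlgClosed.exists_pow_nat_eq ((x + Complex.I * z ^ j) / p) (n := 2)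
          (by norm_num)
        refine ⟨q, by rw [hq]; field_simp, ?_⟩
        have hx : x = Complex.I * z ^ j := by rw [← hr', hr0]; ring
        have : z * y ^ 2 = 0 := by
          rw [hx] at h
          linear_combination h - (z ^ j) ^ 2 * Complex.I_sq
        have hy : y = 0 := by
          rw [← hp] at this
          simpa [hp0] using this
        rw [hr0, hy]
        ring
      · refine ⟨-Complex.I * y / r, ?_, ?_⟩
        · field_simp
          refine mul_left_cancel₀ hp0 ?_
          linear_combination p ^ 2 * y ^ 2 * Complex.I_sq - h - y ^ 2 * hp
            - (x + Complex.I * z ^ j) * hr' + (z ^ j) ^ 2 * Complex.I_sq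
        · field_simp
          linear_combination -y * Complex.I_sq
    refine ⟨p, q, r, mul_left_cancel₀ hp0 ?_, hp, hr', hqr⟩
    linear_combination hq - hr' - 2 * Complex.I * hz

/-- The monomial model of type `D` with an odd number of nodes. -/
noncomputable def modelDodd (j : ℕ) (hj : 2 ≤ j) : MonomialModel (Dodd j hj) where
  node := (nodeD (by omega) : Fin 3 → Fin (2 * j + 1))
  endExp := (![![0, 1, 1], ![2, 0, 0], ![1, 0, 2], ![1, 2, 0], ![0, 0, 4], ![0, 4, 0]] :
    Fin 6 → Fin 3 → ℕ)
  curveExp := (![fun i => forkExp (2 * j + 1) (fun i => i + 1) j j i,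
    fun i => forkExp (2 * j + 1) (fun _ => 2) 1 1 i,
    fun i => forkExp (2 * j + 1) (fun i => i + 2) j (j + 1) i,
    fun i => forkExp (2 * j + 1) (fun i => i + 2) (j + 1) j i,
    fun i => forkExp (2 * j + 1) (fun i => 2 * (i + 1)) (2 * j - 1) (2 * j + 1) i,
    fun i => forkExp (2 * j + 1) (fun i => 2 * (i + 1)) (2 * j + 1) (2 * j - 1) i] :
    Fin 6 → Fin (2 * j + 1) → ℕ)
  scalar := (![Complex.I, 1, 1, 1, -1, -1] : Fin 6 → ℂ)
  scalar_ne_zero := by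
    intro i
    fin_cases i <;> simp
  hasPrimeDivisors := (properTransform_D_spec (n := 2 * j + 1) (by omega)).1
  homogeneous := ⟨_, (properTransform_D_spec (n := 2 * j + 1) (by omega)).2⟩
  pullback_distPoly := by
    obtain ⟨y, z, w₃, w₄, w₅, w₆, m₄, m₅, m₆, hy, hz, hw₃, hw₄, hw₅, hw₆, hb, -, h₄, h₅, h₆⟩ :=
      Dodd_monomials j hj
    have hI : (C Complex.I : MvPolynomial (Fin 3 ⊕ Fin (2 * j + 1)) ℂ) =
      algebraMap ℂ (MvPolynomial (Fin 3 ⊕ Fin (2 * j + 1)) ℂ) Complex.I := rfl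
    have hI2 : (C Complex.I : MvPolynomial (Fin 3 ⊕ Fin (2 * j + 1)) ℂ) ^ 2 = -1 := by
      rw [← C_pow, Complex.I_sq, C_neg, C_1]
    have hC : (C 2 : MvPolynomial (Fin 3 ⊕ Fin (2 * j + 1)) ℂ) = 2 := map_ofNat C 2
    intro i
    rw [hb]
    fin_cases i
    · exact ⟨0, by simp [distPoly, ← hy]⟩
    · exact ⟨0, by simp [distPoly, ← hz]⟩
    · exact ⟨0, by simp [distPoly, ← hw₃, hI]⟩
    · refine Dvd.intro_left (-m₄) ?_
      rw [neg_mul, h₄]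
      simp [distPoly, ← hw₄, hI]
      ring
    · refine Dvd.intro_left (-m₅) ?_
      rw [neg_mul, h₅]
      simp [distPoly, ← hw₅]
      rw [hC]
      linear_combination -y ^ 2 * hI2
    -- The relation for `w₆` involves `w₄`, which agrees with the pull-back of x + iz^j only modulo
    -- the equation; the term with `m₄` corrects this.
    · refine Dvd.intro_left (m₆ + 2 * C Complex.I * z ^ (j - 1) * m₄) ?_
      rw [add_mul, mul_assoc _ m₄, h₆, h₄]
      simp [distPoly, ← hw₆]
      rw [hC]
      linear_combination -y ^ 2 * hI2
  cartan_mulVec_curveExp := by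
    intro i
    ext (t : Fin (2 * j + 1))
    have ht := t.2
    fin_cases i
    · refine (D_mulVec_forkExp (by omega) (fun i => i + 1) j j t).trans ?_
      simp [distCoweight, fundCoweight, -Fin.val_eq_zero_iff]
      split_ifs <;> omega
    · refine (D_mulVec_forkExp (by omega) (fun _ => 2) 1 1 t).trans ?_
      simp [distCoweight, fundCoweight, -Fin.val_eq_zero_iff]
    · refine (D_mulVec_forkExp (by omega) (fun i => i + 2) j (j + 1) t).trans ?_
      simp [distCoweight, fundCoweight, -Fin.val_eq_zero_iff]
      split_ifs <;> omega
    · refine (D_mulVec_forkExp (by omega) (fun i => i + 2) (j + 1) j t).trans ?_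
      simp [distCoweight, fundCoweight, -Fin.val_eq_zero_iff]
      split_ifs <;> omega
    · refine (D_mulVec_forkExp (by omega) (fun i => 2 * (i + 1)) (2 * j - 1) (2 * j + 1) t).trans ?_
      simp [distCoweight, fundCoweight, -Fin.val_eq_zero_iff]
      split_ifs <;> omega
    · refine (D_mulVec_forkExp (by omega) (fun i => 2 * (i + 1)) (2 * j + 1) (2 * j - 1) t).trans ?_
      simp [distCoweight, fundCoweight, -Fin.val_eq_zero_iff]
      split_ifs <;> omega
  endWeight_endExp := by
    intro i
    ext (t : Fin (2 * j + 1))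
    have ht := t.2
    refine (endWeight_nodeD (by omega) _ t).trans ?_
    fin_cases i
    all_goals simp [distCoweight, fundCoweight]
  exists_endExp_eq_sum := Dodd_exists_eq_sum hj
  cartan_injective := D_mulVec_injective (n := 2 * j + 1) (by omega)
  cartan_nonpos := CartanMatrix.D_off_diag_nonpos (2 * j + 1)
  X_mem_range := by
    intro t
    refine ⟨(![C 2⁻¹ * (X 2 + X 3), X 0, X 1] : Fin 3 → MvPolynomial (Fin 6) ℂ) t, ?_⟩
    fin_cases t <;> simp [distPoly]
    linear_combination X 0 * C_inv_two_mul_two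
  dvd_duVal := by
    obtain ⟨y, z, w₃, w₄, w₅, w₆, m₄, m₅, m₆, -, -, -, -, -, -, hb, h, h₄, -, -⟩ :=
      Dodd_monomials j hj
    -- The pull-back of Y is w₃(w₃ + 2iz^j) − w₃w₄, because w₃w₄ = zy² for the monomials.
    refine ⟨-(w₃ * m₄), ?_⟩
    have hI : (C Complex.I : MvPolynomial (Fin 3 ⊕ Fin (2 * j + 1)) ℂ) ^ 2 = -1 := by
      rw [← C_pow, Complex.I_sq, C_neg, C_1]
    have hz' : z ^ (2 * j) = (z ^ j) ^ 2 := pow_mul' z 2 j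
    rw [hb]
    simp [duVal]
    rw [hz']
    linear_combination (z * y ^ 2 + (z ^ j) ^ 2) * hI + h + w₃ * h₄
  duVal_dvd := by
    refine duVal_dvd_of_lift (Dodd j hj) (D_dvd_of_forall_eval _) fun t ht => ?_
    obtain ⟨p, q, r, h1, h2, h3, h4⟩ := Dodd_lift j hj (t 0) (t 1) (t 2)
      (by simpa [duVal] using ht)
    refine ⟨Sum.elim ![p, q, r] fun _ => 1, ?_, ?_⟩
    · simp [properTransform, eval_coordMonomial, Fin.prod_univ_three]
      linear_combination h1
    · intro i
      fin_cases i <;> simp [blowdown, eval_coordMonomial, Fin.prod_univ_three, h2, h3, h4]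

theorem nonempty_monomialModel : ∀ g : DuValType, Nonempty (MonomialModel g)
  | A n hn => ⟨modelA n hn⟩
  | Deven j hj => ⟨modelDeven j hj⟩
  | Dodd j hj => ⟨modelDodd j hj⟩
  | E6 => ⟨modelE6⟩
  | E7 => ⟨modelE7⟩
  | E8 => ⟨modelE8⟩

end DuValType

theorem mainTheorem1 (g : DuValType) (P : MvPolynomial (Fin 3) ℂ)
    (hP : P ∉ Ideal.span {g.duVal}) :
    ∃ lam : g.Coweight, g.IsLambdaOf P lam ∧ g.RealizesQuiver P (g.quiver lam) := by
  obtain ⟨D⟩ := DuValType.nonempty_monomialModel g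
  exact D.exists_isLambdaOf P hP
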